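/- Let $K$ be a field, $n\ge 2$, $R=K[x_1,\dots,x_n]$, and let $M^d$ be the set of monomials of degree $d$ in $R$. For positive integers $m,h$ write the $m$th binomial representation $h=\sum_{j=i}^{m}\binom{h(j)+j}{j}$ with $h(m)\ge h(m-1)\ge\dots\ge h(i)\ge 0$, $m\ge i\ge 1$ (it exists and is unique), and put $h^{\langle m\rangle}=\sum_{j=i}^{m}\binom{h(j)+j+1}{j}$, $0^{\langle m\rangle}=0$. A set $V\subset M^d$ is a Gotzmann set if the ideal $I$ generated by $V$ satisfies $\dim_K I_{d+1}=(\dim_K I_d)^{\langle n-1\rangle}$. A monomial $w=x_1^{b_1}\cdots x_n^{b_n}$ of degree $d$ is under a monomial $v=x_1^{a_1}\cdots x_n^{a_n}$ of degree $d$ for $i$ if $b_j\le a_j$ for all $j\ne i$; and $v\in M^d$ is a fixed empty element of $V$ for $i$ if $v\notin V$ and no monomial of degree $d$ which is under $v$ for $i$ belongs to $V$. **Proposition.** Let $V\subset M^d$ be nonempty and let $u=\gcd(V)$. If $V$ is a Gotzmann set, then (a) every monomial $v\in M^d\setminus V$ is a fixed empty element of $V$ for some $i\in\{1,\dots,n\}$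 (depending on $v$), and (b) $|V|>\binom{d-\deg(u)-1+n-1}{n-1}$. If $n=3$, then conversely every nonempty $V\subset M^d$ satisfying (a) and (b) is a Gotzmann set; so a nonempty $V\subset M^d$ is a Gotzmann set if and only if (a) and (b) hold. -/

import Mathlib

namespace GotzmannSets

/-- `(i, a)` is an `n`-th binomial representation of `h`:
`h = C(a n + n, n) + C(a (n-1) + n-1, n-1) + ⋯ + C(a i + i, i)` with
`a n ≥ a (n-1) ≥ ⋯ ≥ a i ≥ 0` and `n ≥ i ≥ 1`. -/
def IsBinomRep (n h i : ℕ) (a : ℕ → ℕ) : Prop :=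
  1 ≤ i ∧ i ≤ n ∧ (∀ j, i ≤ j → j < n → a j ≤ a (j + 1)) ∧
    h = ∑ j ∈ Finset.Icc i n, (a j + j).choose j

open Classical in
/-- `h^{<n>} = C(a n + n + 1, n) + ⋯ + C(a i + i + 1, i)`, where `(i, a)` is the `n`-th binomial
representation of `h`. The representation exists and is unique for `n, h ≥ 1`
(see `exists_isBinomRep` and `upper_eq`); by convention `0^{<n>} = 0`. -/
noncomputable def upper (n h : ℕ) : ℕ :=
  if hx : ∃ p : ℕ × (ℕ → ℕ), IsBinomRep n h p.1 p.2 then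
    ∑ j ∈ Finset.Icc hx.choose.1 n, (hx.choose.2 j + j + 1).choose j
  else 0

lemma choose_mono_shift {n b c : ℕ} (h : b ≤ c) : (b + n).choose n ≤ (c + n).choose n :=
  Nat.choose_le_choose n (by omega)

lemma IsBinomRep.sum_succ {n h i : ℕ} {a : ℕ → ℕ} (H : IsBinomRep (n + 1) h i a) (hi : i ≤ n) :
    IsBinomRep n (∑ j ∈ Finset.Icc i n, (a j + j).choose j) i a ∧
      h = (∑ j ∈ Finset.Icc i n, (a j + j).choose j) + (a (n + 1) + (n + 1)).choose (n + 1) := by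
  obtain ⟨h1, h2, h3, h4⟩ := H
  refine ⟨⟨h1, hi, fun j hj hj' => h3 j hj (by omega), rfl⟩, ?_⟩
  rw [h4, Finset.sum_Icc_succ_top (by omega)]

lemma IsBinomRep.top_le {n h i : ℕ} {a : ℕ → ℕ} (H : IsBinomRep n h i a) :
    (a n + n).choose n ≤ h := by
  obtain ⟨h1, h2, h3, h4⟩ := H
  rw [h4]
  exact Finset.single_le_sum (f := fun j => (a j + j).choose j) (fun _ _ => Nat.zero_le _)
    (Finset.mem_Icc.2 ⟨h2, le_rfl⟩)

lemma IsBinomRep.pos {n h i : ℕ} {a : ℕ → ℕ} (H : IsBinomRep n h i a) : 0 < h :=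
  lt_of_lt_of_le (Nat.choose_pos (by omega)) H.top_le

lemma IsBinomRep.lt_top {n h i : ℕ} {a : ℕ → ℕ} (H : IsBinomRep n h i a) :
    h < (a n + 1 + n).choose n := by
  induction n generalizing h with
  | zero => obtain ⟨h1, h2, -⟩ := H; omega
  | succ n ih =>
    have e : (a (n + 1) + 1 + (n + 1)).choose (n + 1)
        = (a (n + 1) + 1 + n).choose n + (a (n + 1) + (n + 1)).choose (n + 1) := by
      rw [← add_assoc (a (n + 1) + 1), Nat.choose_succ_succ]
      congr 2
      omega
    by_cases hi : i ≤ n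
    · obtain ⟨H', e'⟩ := H.sum_succ hi
      have h1 := ih H'
      have h2 := choose_mono_shift (n := n) (Nat.add_le_add_right (H.2.2.1 n hi (by omega)) 1)
      omega
    · have hi' : i = n + 1 := by have := H.2.1; omega
      have h4 := H.2.2.2
      subst hi'
      simp only [Finset.Icc_self, Finset.sum_singleton] at h4
      have : 0 < (a (n + 1) + 1 + n).choose n := Nat.choose_pos (by omega)
      omega

lemma IsBinomRep.unique {n h i i' : ℕ} {a a' : ℕ → ℕ} (H : IsBinomRep n h i a)
    (H' : IsBinomRep n h i' a') : i = i' ∧ ∀ j, i ≤ j → j ≤ n → a j = a' j := by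
  induction n generalizing h with
  | zero => obtain ⟨h1, h2, -⟩ := H; omega
  | succ n ih =>
    have htop : a (n + 1) = a' (n + 1) := by
      rcases lt_trichotomy (a (n + 1)) (a' (n + 1)) with hlt | heq | hlt
      · have := choose_mono_shift (n := n + 1) (Nat.succ_le_of_lt hlt)
        exact absurd (lt_of_lt_of_le H.lt_top (this.trans H'.top_le)) (lt_irrefl _)
      · exact heq
      · have := choose_mono_shift (n := n + 1) (Nat.succ_le_of_lt hlt)
        exact absurd (lt_of_lt_of_le H'.lt_top (this.trans H.top_le)) (lt_irrefl _)
    have key : ∀ {i : ℕ} {a : ℕ → ℕ}, IsBinomRep (n + 1) h i a → ¬ i ≤ n →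
        i = n + 1 ∧ h = (a (n + 1) + (n + 1)).choose (n + 1) := by
      intro i a H hi
      have hi' : i = n + 1 := by have := H.2.1; omega
      have h4 := H.2.2.2
      subst hi'
      simp only [Finset.Icc_self, Finset.sum_singleton] at h4
      exact ⟨rfl, h4⟩
    by_cases hi : i ≤ n <;> by_cases hi' : i' ≤ n
    · obtain ⟨R, e⟩ := H.sum_succ hi
      obtain ⟨R', e'⟩ := H'.sum_succ hi'
      rw [← htop] at e'
      have e2 := Nat.add_right_cancel (e.symm.trans e')
      rw [← e2] at R'
      obtain ⟨p, q⟩ := ih R R'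
      refine ⟨p, fun j hj hj' => ?_⟩
      rcases Nat.lt_or_ge n j with hn | hn
      · obtain rfl : j = n + 1 := by omega
        exact htop
      · exact q j hj hn
    · obtain ⟨R, e⟩ := H.sum_succ hi
      have := R.pos
      have e' := (key H' hi').2
      rw [← htop] at e'
      omega
    · obtain ⟨R, e⟩ := H'.sum_succ hi'
      have := R.pos
      have e' := (key H hi).2
      rw [htop] at e'
      omega
    · have p := (key H hi).1
      have p' := (key H' hi').1
      refine ⟨by omega, fun j hj hj' => ?_⟩
      obtain rfl : j = n + 1 := by omega
      exact htop

lemma exists_isBinomRep {n h : ℕ} (hn : 1 ≤ n) (hh : 1 ≤ h) :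
    ∃ i a, IsBinomRep n h i a := by
  induction n generalizing h with
  | zero => omega
  | succ n ih =>
    obtain ⟨b, hb, hb'⟩ : ∃ b, (b + (n + 1)).choose (n + 1) ≤ h ∧
        h < (b + 1 + (n + 1)).choose (n + 1) := by
      have hex : ∃ b, h < (b + (n + 1)).choose (n + 1) := by
        refine ⟨h, ?_⟩
        have : ∀ m : ℕ, m < (m + (n + 1)).choose (n + 1) := by
          intro m
          induction m with
          | zero => simp
          | succ m ihm =>
            have e : (m + 1 + (n + 1)).choose (n + 1)
                = (m + (n + 1)).choose n + (m + (n + 1)).choose (n + 1) := by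
              rw [show m + 1 + (n + 1) = (m + (n + 1)) + 1 by omega, Nat.choose_succ_succ]
            have : 0 < (m + (n + 1)).choose n := Nat.choose_pos (by omega)
            omega
        exact this h
      classical
      have hs := Nat.find_spec hex
      have hm := fun m => Nat.find_min hex (m := m)
      obtain ⟨c, hc⟩ : ∃ c, Nat.find hex = c := ⟨_, rfl⟩
      rw [hc] at hs hm
      cases c with
      | zero => simp at hs; omega
      | succ c => exact ⟨c, not_lt.1 (hm c (by omega)), hs⟩
    have e : (b + 1 + (n + 1)).choose (n + 1)
        = (b + 1 + n).choose n + (b + (n + 1)).choose (n + 1) := by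
      rw [← add_assoc (b + 1), Nat.choose_succ_succ]
      congr 2
      omega
    obtain ⟨r, hr⟩ := Nat.exists_eq_add_of_le hb
    by_cases h0 : r = 0
    · refine ⟨n + 1, fun _ => b, by omega, le_rfl, fun _ _ _ => le_rfl, ?_⟩
      simp only [Finset.Icc_self, Finset.sum_singleton]
      omega
    · have hn0 : 1 ≤ n := by
        rcases Nat.eq_zero_or_pos n with rfl | h'
        · rw [Nat.choose_zero_right] at e
          omega
        · exact h'
      obtain ⟨i, a, H⟩ := ih hn0 (Nat.one_le_iff_ne_zero.2 h0)
      have hab : a n ≤ b := by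
        by_contra hcon
        have := choose_mono_shift (n := n) (Nat.succ_le_of_lt (not_le.1 hcon))
        have h2 := H.top_le
        simp only [Nat.succ_eq_add_one] at this
        omega
      have hi := H.2.1
      refine ⟨i, Function.update a (n + 1) b, H.1, by omega, fun j hj hj' => ?_, ?_⟩
      · rw [Function.update_of_ne (by omega)]
        by_cases hjn : j = n
        · subst hjn; simpa using hab
        · rw [Function.update_of_ne (by omega)]
          exact H.2.2.1 j hj (by omega)
      · rw [Finset.sum_Icc_succ_top (by omega), Function.update_self, hr, add_comm]
        congr 1
        rw [H.2.2.2]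
        refine Finset.sum_congr rfl fun j hj => ?_
        rw [Function.update_of_ne (by have := (Finset.mem_Icc.1 hj).2; omega)]

lemma upper_eq {n h i : ℕ} {a : ℕ → ℕ} (H : IsBinomRep n h i a) :
    upper n h = ∑ j ∈ Finset.Icc i n, (a j + j + 1).choose j := by
  have hx : ∃ p : ℕ × (ℕ → ℕ), IsBinomRep n h p.1 p.2 := ⟨(i, a), H⟩
  rw [upper, dif_pos hx]
  obtain ⟨e, e'⟩ := hx.choose_spec.unique H
  rw [← e]
  refine Finset.sum_congr rfl fun j hj => ?_
  rw [e' j (Finset.mem_Icc.1 hj).1 (Finset.mem_Icc.1 hj).2]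

lemma upper_zero (n : ℕ) : upper n 0 = 0 := by
  rw [upper, dif_neg]
  rintro ⟨p, hp⟩
  exact absurd hp.pos (lt_irrefl _)

/-- The set `M^d` of monomials of degree `d` in `x_1, …, x_n`; a monomial is identified with its
exponent vector, so that divisibility of monomials is the order `≤` on exponent vectors. -/
def monomialsOfDegree (n d : ℕ) : Set (Fin n →₀ ℕ) := {v | v.degree = d}

/-- The ideal of `K[x_1, …, x_n]` generated by the monomials in `V` (it is `0` if `V = ∅`). -/
noncomputable def monomialIdeal (K : Type*) [Field K] {n : ℕ} (V : Finset (Fin n →₀ ℕ)) :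
    Ideal (MvPolynomial (Fin n) K) :=
  Ideal.span ((fun v => MvPolynomial.monomial v (1 : K)) '' (V : Set (Fin n →₀ ℕ)))

/-- The Hilbert function `H(I, d) = dim_K I_d`. -/
noncomputable def hilbertFunction {K : Type*} [Field K] {n : ℕ}
    (I : Ideal (MvPolynomial (Fin n) K)) (d : ℕ) : ℕ :=
  Module.finrank K
    ↥(I.restrictScalars K ⊓ MvPolynomial.homogeneousSubmodule (Fin n) K d)

/-- `V ⊂ M^d` is a Gotzmann set: the ideal `I` generated by `V` satisfies
`H(I, d + 1) = H(I, d)^{<n-1>}`. -/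
def IsGotzmannSet (K : Type*) [Field K] {n : ℕ} (d : ℕ) (V : Finset (Fin n →₀ ℕ)) : Prop :=
  (V : Set (Fin n →₀ ℕ)) ⊆ monomialsOfDegree n d ∧
    hilbertFunction (monomialIdeal K V) (d + 1) =
      upper (n - 1) (hilbertFunction (monomialIdeal K V) d)

/-- The greatest common divisor of a nonempty set of monomials: the infimum for divisibility. -/
noncomputable def gcdMonomial {n : ℕ} (V : Finset (Fin n →₀ ℕ)) (hV : V.Nonempty) : Fin n →₀ ℕ :=
  V.inf' hV id

/-- `v` is under `u` for `i`: all exponents other than the `i`-th one are at most those of `u`.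
Used for monomials `u`, `v` of the same degree. -/
def IsUnder {n : ℕ} (i : Fin n) (v u : Fin n →₀ ℕ) : Prop :=
  ∀ j, j ≠ i → v j ≤ u j

/-- The monomial `u` of degree `d` is a fixed empty element of `V ⊂ M^d` for `i`: `u ∉ V`, and no
monomial of degree `d` which is under `u` for `i` belongs to `V`. -/
def IsFixedEmpty {n : ℕ} (d : ℕ) (V : Finset (Fin n →₀ ℕ)) (i : Fin n) (u : Fin n →₀ ℕ) : Prop :=
  u ∈ monomialsOfDegree n d ∧ u ∉ V ∧ ∀ v ∈ monomialsOfDegree n d, IsUnder i v u → v ∉ V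

/-- Every monomial of degree `d` outside `V` is a fixed empty element of `V` for some `i`. -/
def AllMissingFixedEmpty {n : ℕ} (d : ℕ) (V : Finset (Fin n →₀ ℕ)) : Prop :=
  ∀ v ∈ monomialsOfDegree n d, v ∉ V → ∃ i, IsFixedEmpty d V i v

end GotzmannSets

namespace GotzmannSets

/-! In degree `d` the ideal generated by `V` is spanned by `V`, in degree `d + 1` by the shadow of
`V`. Hence `V` is a Gotzmann set exactly when its shadow has the least size that Macaulay's theorem
permits. Two theorems on sets of monomials carry the proof: Macaulay's bound
`growth_card_le_card_shadow` and Gotzmann's persistence `card_shadow_shadow_eq`, by which all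
iterated shadows of a Gotzmann set stay minimal.

Necessity compares sizes in high degree. For (a), if `v ∉ V` has for every `i` a member of `V` under
it, then adding `v` to `V` does not change a high iterated shadow. Macaulay's bound for `|V| + 1`
then contradicts persistence for `|V|`. For (b), a small `V` has small iterated shadows by
persistence, so many multiples of the gcd `u` are missing from them. But a missing `u z` must have
two small exponents in `z`, and such `z` are of lower order.

Both theorems are proved by compression: in a pair of variables, each fiber of exponents of `x_j` is
replaced by an initial segment of the same size. This does not enlarge the shadow and ends in a
strongly stable set, where splitting off the last variable gives the result. Persistence has to be
carried back through a compression. For this the induction also carries `HasLinearSyzygies`, a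
connectedness property, and uses that equality of shadow sizes forces equality fiber by fiber.

For three variables let `e = d - deg u`. By (b) at most `e` cofactors of degree `e` are missing.
Multiplying each by its fixed empty variable is injective into the missing cofactors of degree `e +
1`, since a collision would produce more than `e` missing ones. This bounds the shadow from above,
and Macaulay bounds it from below. -/

/-! ### Arithmetic of the Macaulay growth function; index `n` belongs to `n + 1` variables. -/

/-- The Macaulay growth function: `upper n h` for `n ≥ 1`, extended to `n = 0` by `min h 1`. -/
noncomputable def growth : ℕ → ℕ → ℕ
  | 0, h => min h 1
  | n + 1, h => upper (n + 1) h

lemma growth_zero_right (n : ℕ) : growth n 0 = 0 := by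
  cases n with
  | zero => simp [growth]
  | succ n => exact upper_zero _

lemma growth_choose (n b : ℕ) : growth n ((b + n).choose n) = (b + 1 + n).choose n := by
  cases n with
  | zero => simp [growth]
  | succ n =>
    have H : IsBinomRep (n + 1) ((b + (n + 1)).choose (n + 1)) (n + 1) (fun _ => b) :=
      ⟨by omega, le_rfl, fun _ _ _ => le_rfl, by simp⟩
    change upper (n + 1) _ = _
    rw [upper_eq H, Finset.Icc_self, Finset.sum_singleton]
    congr 1
    omega

lemma choose_pascal_shift (b n : ℕ) : (b + 1 + (n + 1)).choose (n + 1) =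
    (b + (n + 1)).choose (n + 1) + (b + 1 + n).choose n := by
  rw [← add_assoc (b + 1), Nat.choose_succ_succ, add_comm]
  congr 2
  omega

/-- Prepending a leading binomial to a representation of `r` gives the recursion on the number of
variables. Equality in `hr` is allowed: a full remainder rolls over into the next leading binomial,
and Pascal's rule makes both readings agree. -/
lemma growth_choose_add {n b r : ℕ} (hr : r ≤ (b + 1 + n).choose n) :
    growth (n + 1) ((b + (n + 1)).choose (n + 1) + r) =
      (b + 1 + (n + 1)).choose (n + 1) + growth n r := by
  rcases hr.eq_or_lt with rfl | hr
  · rw [← choose_pascal_shift, growth_choose, growth_choose, choose_pascal_shift]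
  rcases Nat.eq_zero_or_pos r with rfl | hr0
  · rw [add_zero, growth_choose, growth_zero_right, add_zero]
  obtain ⟨m, rfl⟩ : ∃ m, n = m + 1 := by
    rcases n with _ | m
    · rw [Nat.choose_zero_right] at hr; omega
    · exact ⟨m, rfl⟩
  obtain ⟨i, a, H⟩ := exists_isBinomRep (n := m + 1) (by omega) hr0
  have hab : a (m + 1) ≤ b := by
    by_contra hcon
    have := choose_mono_shift (n := m + 1) (Nat.succ_le_of_lt (not_le.1 hcon))
    have h2 := H.top_le
    simp only [Nat.succ_eq_add_one] at this
    omega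
  have hi := H.2.1
  have key : ∀ f : ℕ → ℕ → ℕ,
      ∑ j ∈ Finset.Icc i (m + 1 + 1), f (Function.update a (m + 1 + 1) b j) j =
        f b (m + 1 + 1) + ∑ j ∈ Finset.Icc i (m + 1), f (a j) j := by
    intro f
    rw [Finset.sum_Icc_succ_top (by omega), Function.update_self, add_comm]
    congr 1
    refine Finset.sum_congr rfl fun j hj => ?_
    rw [Function.update_of_ne (by have := (Finset.mem_Icc.1 hj).2; omega)]
  have H' : IsBinomRep (m + 1 + 1) ((b + (m + 1 + 1)).choose (m + 1 + 1) + r) i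
      (Function.update a (m + 1 + 1) b) := by
    refine ⟨H.1, by omega, fun j hj hj' => ?_, ?_⟩
    · rw [Function.update_of_ne (by omega)]
      by_cases hjn : j = m + 1
      · subst hjn; simpa using hab
      · rw [Function.update_of_ne (by omega)]
        exact H.2.2.1 j hj (by omega)
    · rw [key fun x j => (x + j).choose j, H.2.2.2]
  change upper (m + 1 + 1) _ = _ + upper (m + 1) _
  rw [upper_eq H', upper_eq H, key fun x j => (x + j + 1).choose j]
  congr 2
  omega

lemma exists_choose_add {n h : ℕ} (hh : 1 ≤ h) : ∃ b r, r < (b + 1 + n).choose n ∧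
    h = (b + (n + 1)).choose (n + 1) + r := by
  obtain ⟨i, a, H⟩ := exists_isBinomRep (n := n + 1) (by omega) hh
  have h1 := H.top_le
  have h2 := H.lt_top
  rw [choose_pascal_shift] at h2
  exact ⟨a (n + 1), h - (a (n + 1) + (n + 1)).choose (n + 1), by omega, by omega⟩

lemma growth_one (n : ℕ) : growth n 1 = n + 1 := by
  have := growth_choose n 0
  simpa [Nat.add_comm] using this

lemma growth_strictMono (n : ℕ) : StrictMono (growth (n + 1)) := by
  induction n with
  | zero =>
    refine strictMono_nat_of_lt_succ fun h => ?_
    rcases Nat.eq_zero_or_pos h with rfl | hh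
    · rw [growth_zero_right, growth_one]; omega
    · obtain ⟨b, r, hr, rfl⟩ := exists_choose_add (n := 0) hh
      rw [Nat.choose_zero_right] at hr
      obtain rfl : r = 0 := by omega
      rw [add_assoc, growth_choose_add (by simp), growth_choose_add (by simp)]
      simp [growth]
  | succ n ih =>
    refine strictMono_nat_of_lt_succ fun h => ?_
    rcases Nat.eq_zero_or_pos h with rfl | hh
    · rw [growth_zero_right, growth_one]; omega
    · obtain ⟨b, r, hr, rfl⟩ := exists_choose_add (n := n + 1) hh
      rw [add_assoc _ r 1, growth_choose_add hr.le, growth_choose_add hr]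
      exact Nat.add_lt_add_left (ih (Nat.lt_succ_self r)) _

lemma growth_mono (n : ℕ) : Monotone (growth n) := by
  cases n with
  | zero => exact fun a b hab => min_le_min_right 1 hab
  | succ n => exact (growth_strictMono n).monotone

lemma growth_sub_mono {n h h' : ℕ} (hh : h ≤ h') :
    growth (n + 1) h + h' ≤ growth (n + 1) h' + h := by
  induction h', hh using Nat.le_induction with
  | base => exact le_rfl
  | succ k _ ih =>
    have := growth_strictMono n (Nat.lt_succ_self k)
    simp only [Nat.succ_eq_add_one] at this
    omega

lemma growth_le_iff_of_between {n h q c : ℕ} (h1 : growth (n + 1) q ≤ h)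
    (h2 : h < growth (n + 1) (q + 1)) : growth (n + 1) c ≤ h ↔ c ≤ q := by
  constructor
  · intro hc
    have := (growth_strictMono n).lt_iff_lt.1 (hc.trans_lt h2)
    omega
  · exact fun hc => (growth_mono _ hc).trans h1

/-- The number `q` of elements of a lexicographic segment of size `h` that are divisible by the
last variable, and the growth of such a segment in terms of the segment of size `h - q` in one
variable less. -/
lemma exists_growth_eq (n h : ℕ) : ∃ q, q ≤ h ∧ growth (n + 1) q ≤ h ∧
    h < growth (n + 1) (q + 1) ∧ growth (n + 1) h = h + growth n (h - q) := by
  induction n generalizing h with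
  | zero =>
    rcases Nat.eq_zero_or_pos h with rfl | hh
    · exact ⟨0, le_rfl, by rw [growth_zero_right], by rw [growth_one]; omega,
        by simp [growth_zero_right]⟩
    have h1 : ∀ c, 1 ≤ c → growth (0 + 1) c = c + 1 := by
      intro c hc
      obtain ⟨b, rfl⟩ := Nat.exists_eq_add_of_le' hc
      simpa using growth_choose 1 b
    obtain ⟨c, rfl⟩ := Nat.exists_eq_add_of_le' hh
    refine ⟨c, by omega, ?_, by rw [h1 _ hh]; omega, ?_⟩
    · rcases Nat.eq_zero_or_pos c with rfl | hc
      · simp [growth_zero_right]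
      · rw [h1 c hc]
    · rw [h1 _ hh, Nat.add_sub_cancel_left, growth_one]
  | succ n ih =>
    rcases Nat.eq_zero_or_pos h with rfl | hh
    · exact ⟨0, le_rfl, by rw [growth_zero_right], by rw [growth_one]; omega,
        by simp [growth_zero_right]⟩
    obtain ⟨b, r, hr, rfl⟩ := exists_choose_add (n := n + 1) hh
    obtain ⟨q, hqr, hq1, hq2, hq3⟩ := ih r
    cases b with
    | zero =>
      have hr' : r ≤ n + 1 := by
        simp only [Nat.zero_add, Nat.add_comm 1] at hr
        rw [Nat.choose_succ_self_right] at hr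
        omega
      have hq0 : q = 0 := by
        rcases Nat.eq_zero_or_pos q with h0 | h0
        · exact h0
        · have := growth_mono (n + 1) h0
          simp only [Nat.zero_add, Nat.succ_eq_add_one, growth_one] at this
          omega
      subst hq0
      refine ⟨0, Nat.zero_le _, by rw [growth_zero_right]; omega, ?_, ?_⟩
      · simp only [Nat.zero_add, Nat.choose_self, growth_one]
        omega
      · rw [growth_choose_add hr.le, Nat.sub_zero, hq3, Nat.sub_zero]
        have h3 : growth (n + 1) ((0 + (n + 1 + 1)).choose (n + 1 + 1) + r) =
            n + 2 + growth n r := by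
          have : (0 + (n + 1 + 1)).choose (n + 1 + 1) = (0 + (n + 1)).choose (n + 1) := by simp
          rw [this, growth_choose_add]
          · congr 1
            simp [Nat.add_comm 1]
          · rw [Nat.zero_add, Nat.add_comm 1, Nat.choose_succ_self_right]; exact hr'
        rw [h3]
        have : (0 + 1 + (n + 1 + 1)).choose (n + 1 + 1) = n + 3 := by
          rw [Nat.zero_add, Nat.add_comm 1, Nat.choose_succ_self_right]
        rw [this]
        simp only [Nat.zero_add, Nat.choose_self]
        omega
    | succ b =>
      have hlt : q < (b + 1 + (n + 1)).choose (n + 1) := by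
        have := growth_choose (n + 1) (b + 1)
        by_contra hc
        have h4 := growth_mono (n + 1) (not_lt.1 hc)
        omega
      have h5 := choose_pascal_shift b (n + 1)
      -- Lowering the leading index by one inverts the growth of the leading binomial, and the
      -- remainder is inverted by induction. By Pascal's rule the difference is again a leading
      -- binomial plus a remainder.
      refine ⟨(b + (n + 1 + 1)).choose (n + 1 + 1) + q, by omega, ?_, ?_, ?_⟩
      · rw [growth_choose_add hlt.le]
        omega
      · rw [add_assoc _ q 1, growth_choose_add hlt, Nat.succ_eq_add_one]
        omega
      -- The new remainder must fit below its leading binomial: `growth` rises by at least one per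
      -- step, so the gap `e + 1` between `r` and its bound also bounds the gap for `q`.
      · have hb : r - q ≤ (b + 1 + 1 + n).choose n := by
          obtain ⟨e, he⟩ := Nat.exists_eq_add_of_lt hr
          have h6 := growth_choose (n + 1) (b + 1)
          have h7 := choose_pascal_shift (b + 1) n
          by_contra hc
          push Not at hc
          have h9 : (growth (n + 1)) (q + 1 + (e + 1)) ≥ growth (n + 1) (q + 1) + (e + 1) := by
            have := growth_sub_mono (n := n) (show q + 1 ≤ q + 1 + (e + 1) by omega)
            omega
          have h10 := (growth_strictMono n).lt_iff_lt.1
            (show growth (n + 1) ((b + 1 + (n + 1)).choose (n + 1)) <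
              growth (n + 1) (q + 1 + (e + 1)) by omega)
          omega
        have h8 : (b + 1 + (n + 1 + 1)).choose (n + 1 + 1) + r -
            ((b + (n + 1 + 1)).choose (n + 1 + 1) + q) =
            (b + 1 + (n + 1)).choose (n + 1) + (r - q) := by omega
        rw [h8, growth_choose_add hb, growth_choose_add hr.le, hq3, choose_pascal_shift (b + 1)]
        omega

/-- `growth` commutes with passing to one variable less. -/
lemma growth_growth (n h : ℕ) : growth (n + 1) (growth (n + 1) h) =
    growth (n + 1) h + growth n (growth (n + 1) h - h) := by
  obtain ⟨q, -, h2, h3, h4⟩ := exists_growth_eq n (growth (n + 1) h)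
  have e : q = h := by
    have h5 := (growth_strictMono n).le_iff_le.1 h2
    have h6 := (growth_strictMono n).lt_iff_lt.1 h3
    omega
  rw [h4, e]


/-! ### Shadows and the Hilbert function of a monomial ideal -/

/-- The monomials `x_i v` with `i ∈ s` and `v ∈ V`. -/
noncomputable def shadowOn {ι : Type*} (s : Finset ι) (V : Finset (ι →₀ ℕ)) :
    Finset (ι →₀ ℕ) :=
  open Classical in s.biUnion fun i => V.image (· + Finsupp.single i 1)

lemma mem_shadowOn {ι : Type*} {s : Finset ι} {V : Finset (ι →₀ ℕ)} {m : ι →₀ ℕ} :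
    m ∈ shadowOn s V ↔ ∃ i ∈ s, ∃ v ∈ V, v + Finsupp.single i 1 = m := by
  simp [shadowOn]

/-- The monomials `x_i v` with `v ∈ V`. -/
noncomputable def shadow {ι : Type*} [Fintype ι] (V : Finset (ι →₀ ℕ)) : Finset (ι →₀ ℕ) :=
  shadowOn Finset.univ V

lemma mem_shadow {ι : Type*} [Fintype ι] {V : Finset (ι →₀ ℕ)} {m : ι →₀ ℕ} :
    m ∈ shadow V ↔ ∃ i, ∃ v ∈ V, v + Finsupp.single i 1 = m := by
  simp [shadow, mem_shadowOn]

/-- All monomials in `V` have degree `d`. -/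
def IsHomogeneousOfDegree {ι : Type*} (d : ℕ) (V : Finset (ι →₀ ℕ)) : Prop :=
  ∀ v ∈ V, v.degree = d

lemma IsHomogeneousOfDegree.shadowOn {ι : Type*} {d : ℕ} {V : Finset (ι →₀ ℕ)}
    (hV : IsHomogeneousOfDegree d V) (s : Finset ι) :
    IsHomogeneousOfDegree (d + 1) (shadowOn s V) := by
  intro m hm
  obtain ⟨i, -, v, hv, rfl⟩ := mem_shadowOn.1 hm
  rw [map_add, hV v hv, Finsupp.degree_single]

lemma IsHomogeneousOfDegree.shadow {ι : Type*} [Fintype ι] {d : ℕ} {V : Finset (ι →₀ ℕ)}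
    (hV : IsHomogeneousOfDegree d V) : IsHomogeneousOfDegree (d + 1) (shadow V) :=
  hV.shadowOn _

lemma mem_iterate_shadow {ι : Type*} [Fintype ι] {V : Finset (ι →₀ ℕ)} {k : ℕ} {m : ι →₀ ℕ} :
    m ∈ shadow^[k] V ↔ ∃ v ∈ V, ∃ z : ι →₀ ℕ, z.degree = k ∧ v + z = m := by
  induction k generalizing m with
  | zero =>
    simp only [Function.iterate_zero, id_eq, Finsupp.degree_eq_zero_iff]
    constructor
    · exact fun h => ⟨m, h, 0, rfl, add_zero m⟩
    · rintro ⟨v, hv, z, rfl, rfl⟩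
      simpa using hv
  | succ k ih =>
    rw [Function.iterate_succ_apply', mem_shadow]
    constructor
    · rintro ⟨i, v, hv, rfl⟩
      obtain ⟨u, hu, z, hz, rfl⟩ := ih.1 hv
      exact ⟨u, hu, z + Finsupp.single i 1, by rw [map_add, hz, Finsupp.degree_single],
        by rw [add_assoc]⟩
    · rintro ⟨v, hv, z, hz, rfl⟩
      have hz0 : z ≠ 0 := by
        rintro rfl
        simp at hz
      obtain ⟨i, hi⟩ := Finsupp.ne_iff.1 hz0
      have hle : Finsupp.single i 1 ≤ z := by
        rw [Finsupp.single_le_iff]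
        simp only [Finsupp.coe_zero, Pi.zero_apply] at hi
        omega
      obtain ⟨z', rfl⟩ := exists_add_of_le hle
      rw [map_add, Finsupp.degree_single] at hz
      refine ⟨i, v + z', ih.2 ⟨v, hv, z', by omega, rfl⟩, ?_⟩
      rw [add_assoc, add_comm z']

lemma IsHomogeneousOfDegree.iterate_shadow {ι : Type*} [Fintype ι] {d : ℕ}
    {V : Finset (ι →₀ ℕ)} (hV : IsHomogeneousOfDegree d V) (k : ℕ) :
    IsHomogeneousOfDegree (d + k) (GotzmannSets.shadow^[k] V) := by
  intro m hm
  obtain ⟨v, hv, z, hz, rfl⟩ := mem_iterate_shadow.1 hm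
  rw [map_add, hV v hv, hz]

/-- The finset of all monomials of degree `d`. -/
noncomputable def allMonomials (ι : Type*) [Fintype ι] (d : ℕ) : Finset (ι →₀ ℕ) :=
  open Classical in Finset.univ.finsuppAntidiag d

lemma mem_allMonomials {ι : Type*} [Fintype ι] {d : ℕ} {m : ι →₀ ℕ} :
    m ∈ allMonomials ι d ↔ m.degree = d := by
  classical
  simp [allMonomials, Finset.mem_finsuppAntidiag, Finsupp.degree_eq_sum]

lemma card_allMonomials' (ι : Type*) [Fintype ι] (d : ℕ) :
    (allMonomials ι d).card = (Fintype.card ι + d - 1).choose d := by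
  classical
  rw [← Finset.card_univ, ← Finset.card_finsuppAntidiag_nat_eq_choose]
  congr!

lemma card_allMonomials (n d : ℕ) :
    (allMonomials (Fin (n + 1)) d).card = (d + n).choose n := by
  rw [card_allMonomials', Fintype.card_fin, show n + 1 + d - 1 = d + n by omega,
    Nat.choose_symm_add]

/-- A polynomial lies in a monomial ideal iff all its monomials do, so the monomials in `T` form a
basis of the graded piece. -/
lemma hilbertFunction_eq_card {K : Type*} [Field K] {n : ℕ} {V T : Finset (Fin n →₀ ℕ)} {t : ℕ}
    (hT : ∀ m, m ∈ T ↔ m.degree = t ∧ ∃ v ∈ V, v ≤ m) :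
    hilbertFunction (monomialIdeal K V) t = T.card := by
  have e : (monomialIdeal K V).restrictScalars K ⊓ MvPolynomial.homogeneousSubmodule (Fin n) K t =
      MvPolynomial.restrictSupport K (T : Set (Fin n →₀ ℕ)) := by
    ext p
    rw [Submodule.mem_inf, Submodule.restrictScalars_mem, monomialIdeal,
      MvPolynomial.mem_ideal_span_monomial_image, MvPolynomial.mem_homogeneousSubmodule,
      MvPolynomial.mem_restrictSupport_iff]
    constructor
    · rintro ⟨h1, h2⟩ m hm
      refine (hT m).2 ⟨?_, h1 m hm⟩
      rw [Finsupp.degree_eq_weight_one]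
      exact h2 (MvPolynomial.mem_support_iff.1 hm)
    · intro h
      refine ⟨fun m hm => ((hT m).1 (h hm)).2, fun m hm => ?_⟩
      have := ((hT m).1 (h (MvPolynomial.mem_support_iff.2 hm))).1
      rwa [Finsupp.degree_eq_weight_one] at this
  rw [hilbertFunction, e,
    Module.finrank_eq_card_basis (MvPolynomial.basisRestrictSupport K (T : Set (Fin n →₀ ℕ)))]
  simp

lemma isGotzmannSet_iff {K : Type*} [Field K] {n d : ℕ} {V : Finset (Fin (n + 2) →₀ ℕ)}
    (hV : IsHomogeneousOfDegree d V) :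
    IsGotzmannSet K d V ↔ (shadow V).card = growth (n + 1) V.card := by
  have h1 : hilbertFunction (monomialIdeal K V) d = V.card := by
    refine hilbertFunction_eq_card fun m => ⟨fun hm => ⟨hV m hm, m, hm, le_rfl⟩, ?_⟩
    rintro ⟨hm, v, hv, hvm⟩
    obtain ⟨z, rfl⟩ := exists_add_of_le hvm
    rw [map_add, hV v hv] at hm
    obtain rfl : z = 0 := (Finsupp.degree_eq_zero_iff z).1 (by omega)
    simpa using hv
  have h2 : hilbertFunction (monomialIdeal K V) (d + 1) = (shadow V).card := by
    refine hilbertFunction_eq_card fun m => ⟨fun hm => ⟨hV.shadow m hm, ?_⟩, ?_⟩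
    · obtain ⟨i, v, hv, rfl⟩ := mem_shadow.1 hm
      exact ⟨v, hv, le_self_add⟩
    · rintro ⟨hm, v, hv, hvm⟩
      obtain ⟨z, rfl⟩ := exists_add_of_le hvm
      rw [map_add, hV v hv] at hm
      exact (mem_iterate_shadow (k := 1)).2 ⟨v, hv, z, by omega, rfl⟩
  rw [IsGotzmannSet, h1, h2]
  exact and_iff_right fun v hv => hV v hv


/-! ### Macaulay's bound and persistence for strongly stable sets -/

/-- `V` is a strongly stable set of monomials in the variables in `s`. -/
def IsStronglyStableOn {ι : Type*} [LinearOrder ι] (s : Finset ι) (V : Finset (ι →₀ ℕ)) : Prop :=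
  (∀ u ∈ V, u.support ⊆ s) ∧ ∀ u ∈ V, ∀ j, u j ≠ 0 → ∀ i ∈ s, i < j →
    ∃ v ∈ V, v + Finsupp.single j 1 = u + Finsupp.single i 1

/-- The monomials `u` with `x_a u ∈ V`. -/
noncomputable def colonVar {ι : Type*} (a : ι) (V : Finset (ι →₀ ℕ)) : Finset (ι →₀ ℕ) :=
  open Classical in (V.filter (· a ≠ 0)).image (· - Finsupp.single a 1)

lemma sub_add_single {ι : Type*} {a : ι} {u : ι →₀ ℕ} (h : u a ≠ 0) :
    u - Finsupp.single a 1 + Finsupp.single a 1 = u := by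
  refine tsub_add_cancel_of_le ?_
  rw [Finsupp.single_le_iff]
  omega

lemma mem_colonVar {ι : Type*} {a : ι} {V : Finset (ι →₀ ℕ)} {u : ι →₀ ℕ} :
    u ∈ colonVar a V ↔ u + Finsupp.single a 1 ∈ V := by
  classical
  simp only [colonVar, Finset.mem_image, Finset.mem_filter]
  constructor
  · rintro ⟨v, ⟨hv, h0⟩, rfl⟩
    rwa [sub_add_single h0]
  · intro h
    exact ⟨_, ⟨h, by simp⟩, by simp⟩

lemma card_colonVar {ι : Type*} (a : ι) (V : Finset (ι →₀ ℕ)) :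
    (V.filter (· a = 0)).card + (colonVar a V).card = V.card := by
  classical
  rw [colonVar, Finset.card_image_of_injOn, Finset.card_filter_add_card_filter_not]
  intro u hu v hv huv
  rw [← sub_add_single (Finset.mem_filter.1 hu).2, ← sub_add_single (Finset.mem_filter.1 hv).2]
  exact congrArg (· + Finsupp.single a 1) huv

lemma filter_shadowOn {ι : Type*} [DecidableEq ι] (s : Finset ι) (V : Finset (ι →₀ ℕ)) (a : ι) :
    (shadowOn s V).filter (· a = 0) =
      shadowOn (s.erase a) (V.filter (· a = 0)) := by
  ext m
  simp only [Finset.mem_filter, mem_shadowOn, Finset.mem_erase]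
  constructor
  · rintro ⟨⟨i, hi, v, hv, rfl⟩, h0⟩
    rw [Finsupp.add_apply, Nat.add_eq_zero_iff] at h0
    refine ⟨i, ⟨?_, hi⟩, v, ⟨hv, h0.1⟩, rfl⟩
    rintro rfl
    simp at h0
  · rintro ⟨i, ⟨hi, his⟩, v, ⟨hv, h0⟩, rfl⟩
    exact ⟨⟨i, his, v, hv, rfl⟩, by simp [h0, hi]⟩

lemma card_shadowOn_singleton {ι : Type*} (a : ι) (V : Finset (ι →₀ ℕ)) : (shadowOn {a} V).card = V.card := by
  classical
  rw [shadowOn, Finset.singleton_biUnion]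
  exact Finset.card_image_of_injective _ (add_left_injective _)

lemma card_le_one_of_support_subset {ι : Type*} {d : ℕ} {V : Finset (ι →₀ ℕ)} {a : ι} (hd : IsHomogeneousOfDegree d V)
    (hV : ∀ u ∈ V, u.support ⊆ {a}) : V.card ≤ 1 := by
  have key : ∀ u ∈ V, u = Finsupp.single a d := by
    intro u hu
    obtain ⟨b, hb⟩ := (Finsupp.support_subset_singleton').1 (hV u hu)
    rw [hb] at hu ⊢
    rw [← hd _ hu, Finsupp.degree_single]
  exact Finset.card_le_one.2 fun u hu v hv => (key u hu).trans (key v hv).symm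

section

variable {ι : Type*} [LinearOrder ι] {s : Finset ι} {V : Finset (ι →₀ ℕ)} {d : ℕ}

lemma IsStronglyStableOn.shadowOn (hV : IsStronglyStableOn s V) :
    IsStronglyStableOn s (shadowOn s V) := by
  constructor
  · intro m hm
    obtain ⟨k, hk, u, hu, rfl⟩ := mem_shadowOn.1 hm
    refine Finsupp.support_add.trans (Finset.union_subset (hV.1 u hu) ?_)
    exact Finsupp.support_single_subset.trans (by simpa using hk)
  · intro m hm j hj i hi hij
    obtain ⟨k, hk, u, hu, rfl⟩ := mem_shadowOn.1 hm
    by_cases huj : u j = 0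
    · have hkj : k = j := by
        by_contra h
        rw [Finsupp.add_apply, Finsupp.single_apply, if_neg h, huj] at hj
        exact hj rfl
      subst hkj
      exact ⟨u + Finsupp.single i 1, mem_shadowOn.2 ⟨i, hi, u, hu, rfl⟩, add_right_comm _ _ _⟩
    · obtain ⟨v, hv, e⟩ := hV.2 u hu j huj i hi hij
      refine ⟨v + Finsupp.single k 1, mem_shadowOn.2 ⟨k, hk, v, hv, rfl⟩, ?_⟩
      rw [add_right_comm, e, add_right_comm]

lemma IsStronglyStableOn.filter_eq_zero (hV : IsStronglyStableOn s V) {a : ι} :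
    IsStronglyStableOn (s.erase a) (V.filter (· a = 0)) := by
  constructor
  · intro u hu
    rw [Finset.mem_filter] at hu
    intro k hk
    refine Finset.mem_erase.2 ⟨?_, hV.1 u hu.1 hk⟩
    rintro rfl
    exact Finsupp.mem_support_iff.1 hk hu.2
  · intro u hu j hj i hi hij
    rw [Finset.mem_filter] at hu
    rw [Finset.mem_erase] at hi
    obtain ⟨v, hv, e⟩ := hV.2 u hu.1 j hj i hi.2 hij
    refine ⟨v, Finset.mem_filter.2 ⟨hv, ?_⟩, e⟩
    have := DFunLike.congr_fun e a
    rw [Finsupp.add_apply, Finsupp.add_apply, hu.2, Finsupp.single_apply (a := i), if_neg hi.1] at this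
    omega

variable {a : ι} (ha : ∀ i ∈ s, i ≤ a) (has : a ∈ s)
include ha has

lemma IsStronglyStableOn.shadowOn_colonVar_subset (hV : IsStronglyStableOn s V) :
    GotzmannSets.shadowOn s (colonVar a V) ⊆ V := by
  intro m hm
  obtain ⟨i, hi, u, hu, rfl⟩ := mem_shadowOn.1 hm
  rw [mem_colonVar] at hu
  rcases (ha i hi).eq_or_lt with rfl | hlt
  · exact hu
  · obtain ⟨v, hv, e⟩ := hV.2 _ hu a (by simp) i hi hlt
    rw [add_right_comm] at e
    rwa [← add_right_cancel e]

lemma IsStronglyStableOn.colonVar (hV : IsStronglyStableOn s V) :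
    IsStronglyStableOn s (colonVar a V) := by
  constructor
  · intro u hu
    rw [mem_colonVar] at hu
    refine subset_trans ?_ (hV.1 _ hu)
    exact Finsupp.support_mono le_self_add
  · intro u hu j hj i hi hij
    rw [mem_colonVar] at hu
    obtain ⟨v, hv, e⟩ := hV.2 _ hu j (by simp [hj]) i hi hij
    have hva : v a ≠ 0 := by
      have h1 := DFunLike.congr_fun e a
      simp only [Finsupp.add_apply, Finsupp.single_eq_same] at h1
      by_cases hja : j = a
      · subst hja
        rw [Finsupp.single_eq_same] at h1
        omega
      · rw [Finsupp.single_apply (a := j), if_neg hja] at h1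
        omega
    refine ⟨v - Finsupp.single a 1, ?_, ?_⟩
    · rwa [mem_colonVar, sub_add_single hva]
    · refine add_right_cancel (b := Finsupp.single a 1) ?_
      rw [add_right_comm, sub_add_single hva, e, add_right_comm]

/-- If `x_a u = x_i v` with `i < a`, then `x_a` divides `v` and exchanging it for `x_i` gives `u ∈
V`. So the multiples of the last variable in the shadow are counted by `V` itself. -/
lemma IsStronglyStableOn.colonVar_shadowOn (hV : IsStronglyStableOn s V) :
    GotzmannSets.colonVar a (GotzmannSets.shadowOn s V) = V := by
  ext u
  rw [mem_colonVar, mem_shadowOn]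
  constructor
  · rintro ⟨i, hi, v, hv, e⟩
    rcases (ha i hi).eq_or_lt with rfl | hlt
    · rwa [← add_right_cancel e]
    · have hva : v a ≠ 0 := by
        have h1 := DFunLike.congr_fun e a
        simp only [Finsupp.add_apply, Finsupp.single_eq_same] at h1
        rw [Finsupp.single_apply, if_neg hlt.ne] at h1
        omega
      obtain ⟨v', hv', e'⟩ := hV.2 v hv a hva i hi hlt
      rw [e] at e'
      rwa [← add_right_cancel e']
  · exact fun hu => ⟨a, has, u, hu, rfl⟩

lemma IsStronglyStableOn.card_shadowOn (hV : IsStronglyStableOn s V) :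
    (GotzmannSets.shadowOn s V).card =
      V.card + (GotzmannSets.shadowOn (s.erase a) (V.filter (· a = 0))).card := by
  rw [← card_colonVar a, filter_shadowOn s V a, hV.colonVar_shadowOn ha has, add_comm]

end

section

variable {ι : Type*} [LinearOrder ι] {s : Finset ι} {V : Finset (ι →₀ ℕ)} {d n : ℕ}

/-- The shadow of the colon by the last variable lies in `V`, so induction on the degree bounds the
colon by the number `q` of `exists_growth_eq`. Hence at least `|V| - q` elements avoid the last
variable, and induction on the number of variables applies to them. -/
lemma IsStronglyStableOn.growth_le (hn : s.card = n + 1) (hV : IsStronglyStableOn s V)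
    (hd : IsHomogeneousOfDegree d V) : growth n V.card ≤ (GotzmannSets.shadowOn s V).card := by
  induction n generalizing s V d with
  | zero =>
    obtain ⟨a, rfl⟩ := Finset.card_eq_one.1 hn
    rw [card_shadowOn_singleton]
    exact min_le_left _ _
  | succ n ih =>
    have hne : s.Nonempty := Finset.card_pos.1 (by omega)
    obtain ⟨a, has, ha⟩ : ∃ a ∈ s, ∀ i ∈ s, i ≤ a :=
      ⟨s.max' hne, s.max'_mem hne, fun i hi => s.le_max' i hi⟩
    have hcard : (s.erase a).card = n + 1 := by rw [Finset.card_erase_of_mem has]; omega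
    induction d generalizing V with
    | zero =>
      have h0 : V.card = (V.filter (· a = 0)).card := by
        congr 1
        refine (Finset.filter_true_of_mem fun u hu => ?_).symm
        rw [(Finsupp.degree_eq_zero_iff u).1 (hd u hu)]
        rfl
      obtain ⟨q, -, -, -, e⟩ := exists_growth_eq n V.card
      have h1 := ih hcard hV.filter_eq_zero (fun v hv => hd v (Finset.mem_filter.1 hv).1)
      rw [← h0] at h1
      have h3 := growth_mono n (Nat.sub_le V.card q)
      rw [hV.card_shadowOn ha has, e]
      omega
    | succ d ihd =>
      have h1 := ihd (hV.colonVar ha has) (fun u hu => by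
        have := hd _ (mem_colonVar.1 hu)
        rw [map_add, Finsupp.degree_single] at this
        omega)
      have h2 := h1.trans (Finset.card_le_card (hV.shadowOn_colonVar_subset ha has))
      obtain ⟨q, -, hq1, hq2, e⟩ := exists_growth_eq n V.card
      rw [growth_le_iff_of_between hq1 hq2] at h2
      have h3 := card_colonVar a V
      have h4 := ih hcard hV.filter_eq_zero (fun v hv => hd v (Finset.mem_filter.1 hv).1)
      have h5 := growth_mono n (show V.card - q ≤ (V.filter (· a = 0)).card by omega)
      rw [hV.card_shadowOn ha has, e]
      omega

lemma IsStronglyStableOn.card_filter_ge (hn : s.card = n + 2) (hV : IsStronglyStableOn s V)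
    (hd : IsHomogeneousOfDegree d V) {a : ι} (has : a ∈ s) (ha : ∀ i ∈ s, i ≤ a) {q : ℕ}
    (hq1 : growth (n + 1) q ≤ V.card) (hq2 : V.card < growth (n + 1) (q + 1)) :
    V.card - q ≤ (V.filter (· a = 0)).card := by
  -- For `d = 0` the colon is empty, so the truncated `d - 1` does no harm.
  have h1 := (hV.colonVar ha has).growth_le (d := d - 1) hn (fun u hu => by
        have := hd _ (mem_colonVar.1 hu)
        rw [map_add, Finsupp.degree_single] at this
        omega)
  have h2 := h1.trans (Finset.card_le_card (hV.shadowOn_colonVar_subset ha has))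
  rw [growth_le_iff_of_between hq1 hq2] at h2
  have h3 := card_colonVar a V
  omega

/-- Equality in the bound forces equality for the part free of the last variable. Persistence holds
there by induction on the number of variables, and `growth_growth` reassembles the count. -/
lemma IsStronglyStableOn.persistence (hn : s.card = n + 1) (hV : IsStronglyStableOn s V)
    (hd : IsHomogeneousOfDegree d V)
    (hG : (GotzmannSets.shadowOn s V).card = growth n V.card) :
    (GotzmannSets.shadowOn s (GotzmannSets.shadowOn s V)).card = growth n (growth n V.card) := by
  induction n generalizing s V d with
  | zero =>
    obtain ⟨a, rfl⟩ := Finset.card_eq_one.1 hn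
    have := card_le_one_of_support_subset hd hV.1
    rw [card_shadowOn_singleton, card_shadowOn_singleton]
    simp only [growth]
    omega
  | succ n ih =>
    have hne : s.Nonempty := Finset.card_pos.1 (by omega)
    obtain ⟨a, has, ha⟩ : ∃ a ∈ s, ∀ i ∈ s, i ≤ a :=
      ⟨s.max' hne, s.max'_mem hne, fun i hi => s.le_max' i hi⟩
    have hcard : (s.erase a).card = n + 1 := by rw [Finset.card_erase_of_mem has]; omega
    have hd' : IsHomogeneousOfDegree d (V.filter (· a = 0)) :=
      fun v hv => hd v (Finset.mem_filter.1 hv).1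
    obtain ⟨q, -, hq1, hq2, e⟩ := exists_growth_eq n V.card
    have h1 := growth_mono n (hV.card_filter_ge hn hd has ha hq1 hq2)
    have h2 := hV.filter_eq_zero (a := a) |>.growth_le hcard hd'
    have h3 := hV.card_shadowOn ha has
    have h4 := ih hcard hV.filter_eq_zero hd' (by omega)
    have h5 := hV.shadowOn.card_shadowOn ha has
    rw [filter_shadowOn s V a, h4] at h5
    rw [h5, hG, growth_growth]
    congr 2
    omega

end

/-! ### Linear syzygies as connectedness of graphs on the variables -/

/-- The pairs of variables `x_α, x_β` with `w / (x_α x_β) ∈ V`. -/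
def Linked {ι : Type*} (V : Finset (ι →₀ ℕ)) (w : ι →₀ ℕ) (α β : ι) : Prop :=
  ∃ u ∈ V, u + Finsupp.single α 1 + Finsupp.single β 1 = w

lemma Linked.symm {ι : Type*} {V : Finset (ι →₀ ℕ)} {w : ι →₀ ℕ} {α β : ι}
    (h : Linked V w α β) : Linked V w β α := by
  obtain ⟨u, hu, e⟩ := h
  exact ⟨u, hu, by rw [add_right_comm, e]⟩

/-- For `V` homogeneous of degree `d`, this says that the ideal generated by `V` has no minimal
first syzygies in degree `d + 2`. -/
def HasLinearSyzygies {ι : Type*} (V : Finset (ι →₀ ℕ)) : Prop :=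
  ∀ w α β γ δ, Linked V w α β → Linked V w γ δ → Relation.ReflTransGen (Linked V w) α γ

/-- Every vertex of the graph of `w` is equal or adjacent to the largest variable dividing `w`, by
one exchange. -/
lemma IsStronglyStableOn.hasLinearSyzygies {ι : Type*} [LinearOrder ι] [Fintype ι]
    {V : Finset (ι →₀ ℕ)} (hV : IsStronglyStableOn Finset.univ V) : HasLinearSyzygies V := by
  intro w α β γ δ h1 h2
  have hne : w.support.Nonempty := by
    obtain ⟨u, -, rfl⟩ := h1
    exact ⟨β, by simp⟩
  obtain ⟨μ, hμ, hmax⟩ : ∃ μ ∈ w.support, ∀ i ∈ w.support, i ≤ μ :=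
    ⟨w.support.max' hne, w.support.max'_mem hne, fun i hi => w.support.le_max' i hi⟩
  have key : ∀ {α β}, Linked V w α β → α = μ ∨ Linked V w α μ := by
    rintro α β ⟨u, hu, e⟩
    by_cases hα : α = μ
    · exact Or.inl hα
    right
    by_cases hβ : β = μ
    · subst hβ
      exact ⟨u, hu, e⟩
    have huμ : u μ ≠ 0 := by
      have := DFunLike.congr_fun e μ
      rw [Finsupp.add_apply, Finsupp.add_apply, Finsupp.single_apply, if_neg hα,
        Finsupp.single_apply, if_neg hβ] at this
      rw [Finsupp.mem_support_iff] at hμ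
      omega
    have hlt : β < μ := lt_of_le_of_ne (hmax β (by rw [← e]; simp)) hβ
    obtain ⟨v, hv, e'⟩ := hV.2 u hu μ huμ β (Finset.mem_univ _) hlt
    exact ⟨v, hv, by rw [add_right_comm, e', add_right_comm, e]⟩
  have r1 : Relation.ReflTransGen (Linked V w) α μ := by
    rcases key h1 with rfl | h
    · exact .refl
    · exact .single h
  have r2 : Relation.ReflTransGen (Linked V w) μ γ := by
    rcases key h2 with rfl | h
    · exact .refl
    · exact .single h.symm
  exact r1.trans r2


/-! ### Exponent sets in two variables -/

/-- The shadow of a set of exponents in two variables. -/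
def lineShadow (A : Finset ℕ) : Finset ℕ := A ∪ A.image (· + 1)

lemma mem_lineShadow {A : Finset ℕ} {t : ℕ} :
    t ∈ lineShadow A ↔ t ∈ A ∨ ∃ s ∈ A, s + 1 = t := by
  simp [lineShadow]

lemma subset_lineShadow (A : Finset ℕ) : A ⊆ lineShadow A := Finset.subset_union_left

lemma succ_mem_lineShadow {A : Finset ℕ} {t : ℕ} (h : t ∈ A) : t + 1 ∈ lineShadow A :=
  mem_lineShadow.2 (Or.inr ⟨t, h, rfl⟩)

lemma lineShadow_mono {A B : Finset ℕ} (h : A ⊆ B) : lineShadow A ⊆ lineShadow B :=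
  Finset.union_subset_union h (Finset.image_subset_image h)

lemma lineShadow_empty : lineShadow ∅ = ∅ := rfl

lemma max_succ_mem_lineShadow_sdiff {A : Finset ℕ} (hA : A.Nonempty) :
    A.max' hA + 1 ∈ lineShadow A \ A := by
  refine Finset.mem_sdiff.2 ⟨succ_mem_lineShadow (A.max'_mem hA), fun h => ?_⟩
  have := A.le_max' _ h
  omega

lemma card_lineShadow_sdiff (A : Finset ℕ) :
    (lineShadow A \ A).card + A.card = (lineShadow A).card :=
  Finset.card_sdiff_add_card_eq_card (subset_lineShadow A)

lemma card_add_one_le_card_lineShadow {A : Finset ℕ} (hA : A.Nonempty) :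
    A.card + 1 ≤ (lineShadow A).card := by
  have h1 := card_lineShadow_sdiff A
  have h2 := Finset.card_pos.2 ⟨_, max_succ_mem_lineShadow_sdiff hA⟩
  omega

/-- What the second shadow adds is a translate of part of what the first one added, so the
increments do not increase. -/
lemma card_lineShadow_lineShadow_le (A : Finset ℕ) :
    (lineShadow (lineShadow A)).card + A.card ≤ (lineShadow A).card + (lineShadow A).card := by
  have h1 := card_lineShadow_sdiff A
  have h2 := card_lineShadow_sdiff (lineShadow A)
  have h3 : lineShadow (lineShadow A) \ lineShadow A ⊆ (lineShadow A \ A).image (· + 1) := by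
    intro t ht
    obtain ⟨ht1, ht2⟩ := Finset.mem_sdiff.1 ht
    rcases mem_lineShadow.1 ht1 with h | ⟨s, hs, rfl⟩
    · exact absurd h ht2
    · exact Finset.mem_image.2 ⟨s, Finset.mem_sdiff.2
        ⟨hs, fun h => ht2 (succ_mem_lineShadow h)⟩, rfl⟩
  have h4 := (Finset.card_le_card h3).trans Finset.card_image_le
  omega

/-- The maximum plus one is always new. If it is the only new element, no new element lies below a
member of `A`. -/
lemma mem_of_card_lineShadow_le {A : Finset ℕ} {t : ℕ} (h : (lineShadow A).card ≤ A.card + 1)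
    (h1 : t ∈ lineShadow A) (h2 : t + 1 ∈ lineShadow A) : t ∈ A := by
  by_contra ht
  have h3 : t + 1 ∈ A := by
    rcases mem_lineShadow.1 h2 with h | ⟨s, hs, hst⟩
    · exact h
    · obtain rfl : s = t := by omega
      exact absurd hs ht
  have h4 := max_succ_mem_lineShadow_sdiff ⟨_, h3⟩
  have h5 := A.le_max' _ h3
  have h6 := Finset.card_le_one.1 (by have := card_lineShadow_sdiff A; omega) _ h4 t
    (Finset.mem_sdiff.2 ⟨h1, ht⟩)
  omega

/-- `A` is an initial segment of `ℕ`. -/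
def IsInitialSegment (A : Finset ℕ) : Prop := ∀ t ∈ A, ∀ s ≤ t, s ∈ A

lemma isInitialSegment_range (n : ℕ) : IsInitialSegment (Finset.range n) := by
  intro t ht s hs
  rw [Finset.mem_range] at *
  omega

lemma IsInitialSegment.eq_range {A : Finset ℕ} (hA : IsInitialSegment A) :
    A = Finset.range A.card := by
  refine Finset.eq_of_subset_of_card_le (fun t ht => ?_) (by simp)
  have : Finset.range (t + 1) ⊆ A := by
    intro s hs
    exact hA t ht s (by have := Finset.mem_range.1 hs; omega)
  have := Finset.card_le_card this
  rw [Finset.card_range] at this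
  exact Finset.mem_range.2 (by omega)

lemma IsInitialSegment.mem_iff {A : Finset ℕ} (hA : IsInitialSegment A) {t : ℕ} :
    t ∈ A ↔ t < A.card := by
  conv_lhs => rw [hA.eq_range]
  exact Finset.mem_range

lemma IsInitialSegment.lineShadow {A : Finset ℕ} (hA : IsInitialSegment A) :
    IsInitialSegment (lineShadow A) := by
  intro t ht s hs
  rcases mem_lineShadow.1 ht with h | ⟨r, hr, rfl⟩
  · exact subset_lineShadow A (hA t h s hs)
  · rcases hs.eq_or_lt with rfl | hlt
    · exact ht
    · exact subset_lineShadow A (hA r hr s (by omega))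

lemma IsInitialSegment.card_lineShadow {A : Finset ℕ} (hA : IsInitialSegment A)
    (hne : A.Nonempty) : (GotzmannSets.lineShadow A).card = A.card + 1 := by
  refine le_antisymm ?_ (card_add_one_le_card_lineShadow hne)
  rw [← Finset.card_range (A.card + 1)]
  refine Finset.card_le_card fun t ht => Finset.mem_range.2 ?_
  rcases mem_lineShadow.1 ht with h | ⟨r, hr, rfl⟩
  · have := hA.mem_iff.1 h
    omega
  · have := hA.mem_iff.1 hr
    omega

/-- If a graph with weights on vertices and edges is connected in every level, then one can walk
from any vertex to a vertex of maximal weight along edges whose weight is at least that of their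
starting point. -/
lemma reflTransGen_of_levels_connected {ι : Type*} {x : ι → ℕ} {y : ι → ι → ℕ} {r : ι → ι → Prop}
    (hyx : ∀ v w, y v w ≤ x w) (hL : ∀ v w, x v ≤ y v w → r v w)
    (H : ∀ t v w, t < x v → t < x w → Relation.ReflTransGen (fun a b => t < y a b) v w)
    {z : ι} (hz : ∀ v, x v ≤ x z) (v : ι) (hv : 0 < x v) : Relation.ReflTransGen r v z := by
  induction hk : x z - x v using Nat.strong_induction_on generalizing v with
  | _ k ih =>
    -- Follow a path to `z` at level `x v - 1`. While the weight equals `x v`, its edges are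
    -- admissible; once the weight exceeds `x v`, the induction hypothesis takes over.
    have key : ∀ u, Relation.ReflTransGen (fun a b => x v - 1 < y a b) u z → x v ≤ x u →
        Relation.ReflTransGen r u z := by
      intro u hu
      induction hu using Relation.ReflTransGen.head_induction_on with
      | refl => exact fun _ => .refl
      | head h1 _ ih' =>
        rename_i a c _
        intro ha
        have h2 := hyx a c
        rcases ha.eq_or_lt with he | hlt
        · exact .head (hL _ _ (by omega)) (ih' (by omega))
        · exact ih (x z - x a) (by have := hz a; omega) a (by omega) rfl
    exact key v (H _ v z (by omega) (by have := hz v; omega)) le_rfl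

/-! ### Families of fibers: compression and rigidity -/

section Family

variable {ι : Type*}

open Classical in
/-- Multiplication by the variable `x_v` on families of exponent sets, where `x_i` and `x_j` are
treated together, as `v = i`. -/
noncomputable def familyMul (i j v : ι) (A : (ι →₀ ℕ) → Finset ℕ) (m : ι →₀ ℕ) : Finset ℕ :=
  if v = j then ∅ else if v = i then lineShadow (A m) else
    if m v = 0 then ∅ else A (m - Finsupp.single v 1)

/-- The shadow of a family of exponent sets. -/
noncomputable def familyShadow [Fintype ι] (i j : ι) (A : (ι →₀ ℕ) → Finset ℕ) (m : ι →₀ ℕ) :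
    Finset ℕ :=
  Finset.univ.biUnion fun v => familyMul i j v A m

variable {i j : ι} {A B : (ι →₀ ℕ) → Finset ℕ} {m : ι →₀ ℕ}

lemma familyMul_snd : familyMul i j j A m = ∅ := if_pos rfl

lemma familyMul_fst (hij : i ≠ j) : familyMul i j i A m = lineShadow (A m) := by
  rw [familyMul, if_neg hij, if_pos rfl]

lemma familyMul_zero {v : ι} (hi : v ≠ i) (hm : m v = 0) : familyMul i j v A m = ∅ := by
  rw [familyMul, if_neg hi, if_pos hm, ite_self]

lemma familyMul_of_ne {v : ι} (hi : v ≠ i) (hj : v ≠ j) (hm : m v ≠ 0) :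
    familyMul i j v A m = A (m - Finsupp.single v 1) := by
  rw [familyMul, if_neg hj, if_neg hi, if_neg hm]

lemma familyMul_mono (h : ∀ m, A m ⊆ B m) (v : ι) (m : ι →₀ ℕ) :
    familyMul i j v A m ⊆ familyMul i j v B m := by
  unfold familyMul
  split_ifs
  · exact subset_rfl
  · exact lineShadow_mono (h m)
  · exact subset_rfl
  · exact h _

lemma familyMul_comm (v w : ι) :
    familyMul i j v (familyMul i j w A) m = familyMul i j w (familyMul i j v A) m := by
  classical
  by_cases hvw : v = w
  · rw [hvw]
  unfold familyMul
  by_cases hv : v = j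
  · simp [hv, lineShadow_empty]
  by_cases hw : w = j
  · simp [hw, lineShadow_empty]
  by_cases hvi : v = i
  · subst hvi
    simp only [if_neg hv, if_neg hw, if_neg (Ne.symm hvw), if_true]
    split_ifs <;> simp [lineShadow_empty]
  by_cases hwi : w = i
  · subst hwi
    simp only [if_neg hv, if_neg hw, if_neg hvw, if_true]
    split_ifs <;> simp [lineShadow_empty]
  have e1 : (m - Finsupp.single v 1 : ι →₀ ℕ) w = m w := by
    rw [Finsupp.tsub_apply, Finsupp.single_apply, if_neg hvw, tsub_zero]
  have e2 : (m - Finsupp.single w 1 : ι →₀ ℕ) v = m v := by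
    rw [Finsupp.tsub_apply, Finsupp.single_apply, if_neg (Ne.symm hvw), tsub_zero]
  simp only [if_neg hv, if_neg hw, if_neg hvi, if_neg hwi, e1, e2]
  split_ifs <;> simp [tsub_right_comm]

lemma IsInitialSegment.familyMul (hA : ∀ m, IsInitialSegment (A m)) (v : ι) (m : ι →₀ ℕ) :
    IsInitialSegment (familyMul i j v A m) := by
  unfold GotzmannSets.familyMul
  split_ifs
  · simp [IsInitialSegment]
  · exact (hA m).lineShadow
  · simp [IsInitialSegment]
  · exact hA _

lemma card_familyMul_range_le (v : ι) (m : ι →₀ ℕ) :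
    (familyMul i j v (fun m => Finset.range (A m).card) m).card ≤
      (familyMul i j v A m).card := by
  unfold familyMul
  split_ifs
  · exact le_rfl
  · rcases (A m).eq_empty_or_nonempty with h | h
    · simp [h]
    · rw [(isInitialSegment_range _).card_lineShadow (by simpa using h.ne_empty), Finset.card_range]
      exact card_add_one_le_card_lineShadow h
  · exact le_rfl
  · simp

variable [Fintype ι]

lemma mem_familyShadow {t : ℕ} : t ∈ familyShadow i j A m ↔ ∃ v, t ∈ familyMul i j v A m := by
  simp [familyShadow]

lemma familyMul_subset_familyShadow (v : ι) : familyMul i j v A m ⊆ familyShadow i j A m :=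
  fun _ ht => mem_familyShadow.2 ⟨v, ht⟩

lemma IsInitialSegment.familyShadow (hA : ∀ m, IsInitialSegment (A m)) (m : ι →₀ ℕ) :
    IsInitialSegment (familyShadow i j A m) := by
  intro t ht s hs
  obtain ⟨v, hv⟩ := mem_familyShadow.1 ht
  exact mem_familyShadow.2 ⟨v, IsInitialSegment.familyMul hA v m t hv s hs⟩

lemma mem_familyMul_familyShadow {v : ι} {t : ℕ} :
    t ∈ familyMul i j v (familyShadow i j A) m ↔
      ∃ w, t ∈ familyMul i j v (familyMul i j w A) m := by
  constructor
  · intro h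
    unfold familyMul at h
    split_ifs at h with h1 h2 h3
    · simp at h
    · subst h2
      rcases mem_lineShadow.1 h with h | ⟨s, hs, rfl⟩
      · obtain ⟨w, hw⟩ := mem_familyShadow.1 h
        exact ⟨w, by rw [familyMul_fst h1]; exact subset_lineShadow _ hw⟩
      · obtain ⟨w, hw⟩ := mem_familyShadow.1 hs
        exact ⟨w, by rw [familyMul_fst h1]; exact succ_mem_lineShadow hw⟩
    · simp at h
    · obtain ⟨w, hw⟩ := mem_familyShadow.1 h
      exact ⟨w, by rwa [familyMul_of_ne h2 h1 h3]⟩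
  · rintro ⟨w, hw⟩
    exact familyMul_mono (fun m => familyMul_subset_familyShadow w) v m hw

/-- Initial segments are nested, so their union is the largest of them. -/
lemma exists_card_familyShadow_eq [Nonempty ι] (hA : ∀ m, IsInitialSegment (A m))
    (m : ι →₀ ℕ) : ∃ v, familyShadow i j A m = familyMul i j v A m := by
  obtain ⟨v, hv⟩ := Finite.exists_max fun v => (familyMul i j v A m).card
  refine ⟨v, subset_antisymm (fun t ht => ?_) (familyMul_subset_familyShadow v)⟩
  obtain ⟨w, hw⟩ := mem_familyShadow.1 ht
  rw [(IsInitialSegment.familyMul hA _ m).mem_iff] at hw ⊢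
  exact hw.trans_le (hv w)

/-- The compression of a family: each set is replaced by the initial segment of the same size. -/
def familyCompress (A : (ι →₀ ℕ) → Finset ℕ) (m : ι →₀ ℕ) : Finset ℕ := Finset.range (A m).card

omit [Fintype ι] in
lemma isInitialSegment_familyCompress (A : (ι →₀ ℕ) → Finset ℕ) (m : ι →₀ ℕ) :
    IsInitialSegment (familyCompress A m) := isInitialSegment_range _

lemma card_familyShadow_compress_le [Nonempty ι] (m : ι →₀ ℕ) :
    (familyShadow i j (familyCompress A) m).card ≤ (familyShadow i j A m).card := by
  obtain ⟨v, hv⟩ := exists_card_familyShadow_eq (i := i) (j := j)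
    (isInitialSegment_familyCompress A) m
  rw [hv]
  exact (card_familyMul_range_le v m).trans
    (Finset.card_le_card (familyMul_subset_familyShadow v))

section Rigidity

variable (hij : i ≠ j)
  (hcard : ∀ m, (familyShadow i j A m).card = (familyShadow i j (familyCompress A) m).card)
include hij hcard

omit hij in
-- Under `hcard`, a variable that alone produces the compressed shadow at `m` also alone produces
-- the original one: the chain of size inequalities collapses.
lemma familyShadow_eq_of_card_le {v : ι} (h : (familyShadow i j (familyCompress A) m).card ≤
    (familyMul i j v (familyCompress A) m).card) :
    familyShadow i j A m = familyMul i j v A m := by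
  refine (Finset.eq_of_subset_of_card_le (familyMul_subset_familyShadow v) ?_).symm
  rw [hcard]
  exact h.trans (card_familyMul_range_le v m)

lemma familyMul_familyShadow_subset {v w : ι}
    (h : (familyMul i j v (familyShadow i j (familyCompress A)) m).card ≤
      (familyMul i j v (familyMul i j w (familyCompress A)) m).card) :
    familyMul i j v (familyShadow i j A) m ⊆ familyMul i j v (familyMul i j w A) m := by
  by_cases hj : v = j
  · rw [hj, familyMul_snd]; exact Finset.empty_subset _
  by_cases hi : v = i
  · subst hi
    rw [familyMul_fst hij, familyMul_fst hij] at h ⊢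
    rw [familyShadow_eq_of_card_le hcard (v := w)]
    have s1 := IsInitialSegment.familyShadow (i := v) (j := j)
      (isInitialSegment_familyCompress A) m
    have s2 := IsInitialSegment.familyMul (i := v) (j := j)
      (isInitialSegment_familyCompress A) w m
    rcases Finset.eq_empty_or_nonempty (familyShadow v j (familyCompress A) m) with h0 | h0
    · simp [h0]
    · rw [s1.card_lineShadow h0] at h
      rcases Finset.eq_empty_or_nonempty (familyMul v j w (familyCompress A) m) with h1 | h1
      · rw [h1, lineShadow_empty] at h
        simp at h
      · rw [s2.card_lineShadow h1] at h
        omega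
  · by_cases hm : m v = 0
    · rw [familyMul_zero hi hm]; exact Finset.empty_subset _
    · rw [familyMul_of_ne hi hj hm, familyMul_of_ne hi hj hm] at h ⊢
      rw [familyShadow_eq_of_card_le hcard h]

omit hij in
lemma card_familyMul_familyShadow {v : ι} (hi : v ≠ i) :
    (familyMul i j v (familyShadow i j A) m).card =
      (familyMul i j v (familyShadow i j (familyCompress A)) m).card := by
  unfold familyMul
  split_ifs
  · rfl
  · rfl
  · exact hcard _

lemma exists_familyShadow_eq (m : ι →₀ ℕ) : ∃ v, familyShadow i j A m = familyMul i j v A m ∧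
    (v = i → (lineShadow (A m)).card ≤ (A m).card + 1) := by
  have : Nonempty ι := ⟨i⟩
  obtain ⟨v, hv⟩ := exists_card_familyShadow_eq (i := i) (j := j)
    (isInitialSegment_familyCompress A) m
  have e := familyShadow_eq_of_card_le hcard (v := v) (by rw [hv])
  refine ⟨v, e, ?_⟩
  rintro rfl
  have h := hcard m
  rw [e, hv, familyMul_fst hij, familyMul_fst hij] at h
  rw [h]
  rcases (A m).eq_empty_or_nonempty with h0 | h0
  · simp [familyCompress, h0, lineShadow_empty]
  · rw [(isInitialSegment_familyCompress A m).card_lineShadow (by simpa [familyCompress] using h0.ne_empty),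
      familyCompress, Finset.card_range]

/-- A single variable produces the whole fiber, and if it is `x_i` then only the top element is new.
This later joins `i` to `j` in the graph `Linked`. -/
lemma mem_or_of_mem_familyShadow {t : ℕ} (h1 : t ∈ familyShadow i j A m)
    (h2 : t + 1 ∈ familyShadow i j A m) :
    t ∈ A m ∨ ∃ v, v ≠ i ∧ t ∈ familyMul i j v A m ∧ t + 1 ∈ familyMul i j v A m := by
  obtain ⟨v, e, hv⟩ := exists_familyShadow_eq hij hcard m
  rw [e] at h1 h2
  by_cases hi : v = i
  · subst hi
    rw [familyMul_fst hij] at h1 h2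
    exact Or.inl (mem_of_card_lineShadow_le (hv rfl) h1 h2)
  · exact Or.inr ⟨v, hi, h1, h2⟩

variable (H : ∀ t v w, t ∈ familyMul i j v (familyShadow i j (familyCompress A)) m →
  t ∈ familyMul i j w (familyShadow i j (familyCompress A)) m →
  Relation.ReflTransGen
    (fun a b => t ∈ familyMul i j a (familyMul i j b (familyCompress A)) m) v w)
include H

/-- `H` makes the compressed graph connected at every level, so `reflTransGen_of_levels_connected`
climbs to a vertex `z` of maximal size. Along each edge used, the compressed product by two
variables fills the compressed part of the first, and rigidity transfers this to an inclusion for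
`A`. -/
lemma exists_forall_reflTransGen :
    ∃ z, (∀ v, (familyMul i j v (familyShadow i j (familyCompress A)) m).card ≤
        (familyMul i j z (familyShadow i j (familyCompress A)) m).card) ∧
      ∀ v, (familyMul i j v (familyShadow i j A) m).Nonempty →
      Relation.ReflTransGen (fun a b => familyMul i j a (familyShadow i j A) m ⊆
        familyMul i j a (familyMul i j b A) m) v z := by
  have : Nonempty ι := ⟨i⟩
  obtain ⟨z, hz⟩ := Finite.exists_max fun v =>
    (familyMul i j v (familyShadow i j (familyCompress A)) m).card
  refine ⟨z, hz, fun v hv => ?_⟩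
  have s1 := fun v => IsInitialSegment.familyMul (i := i) (j := j) (IsInitialSegment.familyShadow
    (i := i) (j := j) (isInitialSegment_familyCompress A)) v m
  have s2 := fun v w => IsInitialSegment.familyMul (i := i) (j := j) (IsInitialSegment.familyMul
    (i := i) (j := j) (isInitialSegment_familyCompress A) w) v m
  refine reflTransGen_of_levels_connected
    (x := fun v => (familyMul i j v (familyShadow i j (familyCompress A)) m).card)
    (y := fun v w => (familyMul i j v (familyMul i j w (familyCompress A)) m).card)
    (fun v w => ?_) (fun v w => familyMul_familyShadow_subset hij hcard) (fun t v w h1 h2 => ?_)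
    hz v ?_
  · rw [familyMul_comm]
    exact Finset.card_le_card
      (familyMul_mono (fun m => familyMul_subset_familyShadow v) w m)
  · simp only [← (s1 _).mem_iff] at h1 h2
    simp only [← (s2 _ _).mem_iff]
    exact H t v w h1 h2
  · rw [Finset.card_pos]
    by_contra h0
    rw [Finset.not_nonempty_iff_eq_empty] at h0
    -- The index `j` serves as a dummy whose products are empty.
    have := familyMul_familyShadow_subset hij hcard (v := v) (w := j) (m := m) (by rw [h0]; simp)
    rw [familyMul_comm, familyMul_snd] at this
    exact hv.ne_empty (Finset.subset_empty.1 this)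

lemma reflTransGen_of_mem_familyMul {t : ℕ} {v w : ι}
    (hv : t ∈ familyMul i j v (familyShadow i j A) m)
    (hw : t ∈ familyMul i j w (familyShadow i j A) m) :
    Relation.ReflTransGen (fun a b => t ∈ familyMul i j a (familyMul i j b A) m) v w := by
  obtain ⟨z, -, hz⟩ := exists_forall_reflTransGen hij hcard H
  have key : ∀ u, t ∈ familyMul i j u (familyShadow i j A) m →
      Relation.ReflTransGen (fun a b => t ∈ familyMul i j a (familyMul i j b A) m) u z := by
    intro u hu
    have := hz u ⟨t, hu⟩
    induction this using Relation.ReflTransGen.head_induction_on with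
    | refl => exact .refl
    | head h1 _ ih =>
      refine .head (h1 hu) (ih ?_)
      have h2 := h1 hu
      rw [familyMul_comm] at h2
      exact familyMul_mono (fun m => familyMul_subset_familyShadow _) _ m h2
  refine (key v hv).trans ?_
  have h3 := (key w hw).swap
  refine Relation.ReflTransGen.mono (fun a b hab => ?_) _ _ h3
  rw [familyMul_comm]
  exact hab

/-- Along the paths to `z` the parts only grow, so the second shadow of `A` equals its `z`-part. For
`z ≠ i` the sizes agree by `hcard`. For `z = i`, either the shadow is a line shadow with at most one
new element, or it comes from some `x_v`, and commuting `x_v` past the line shadow reduces to the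
`v`-part. -/
lemma card_familyShadow_familyShadow_le :
    (familyShadow i j (familyShadow i j A) m).card ≤
      (familyShadow i j (familyShadow i j (familyCompress A)) m).card := by
  obtain ⟨z, hmax, hz⟩ := exists_forall_reflTransGen hij hcard H
  have h1 : familyShadow i j (familyShadow i j A) m ⊆ familyMul i j z (familyShadow i j A) m := by
    intro t ht
    obtain ⟨v, hv⟩ := mem_familyShadow.1 ht
    have := hz v ⟨t, hv⟩
    induction this using Relation.ReflTransGen.head_induction_on with
    | refl => exact hv
    | head h1 _ ih =>
      have h2 := h1 hv
      rw [familyMul_comm] at h2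
      exact ih (familyMul_mono (fun m => familyMul_subset_familyShadow _) _ m h2)
  refine (Finset.card_le_card h1).trans
    (le_trans ?_ (Finset.card_le_card (familyMul_subset_familyShadow z)))
  by_cases hzi : z = i
  · subst hzi
    obtain ⟨v, e, hv⟩ := exists_familyShadow_eq hij hcard m
    by_cases hvz : v = z
    · subst hvz
      have s1 := IsInitialSegment.familyShadow (i := v) (j := j)
        (isInitialSegment_familyCompress A) m
      have h2 := hcard m
      have h3 := hv rfl
      rw [familyMul_fst hij] at e ⊢
      rw [familyMul_fst hij]
      have h4 := card_lineShadow_lineShadow_le (A m)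
      rcases Finset.eq_empty_or_nonempty (familyShadow v j (familyCompress A) m) with h0 | h0
      · rw [h0, Finset.card_empty, Finset.card_eq_zero] at h2
        rw [h2, lineShadow_empty]
        simp
      · rw [s1.card_lineShadow h0, ← h2, e]
        omega
    · refine le_trans ?_ (hmax v)
      rw [← card_familyMul_familyShadow hcard hvz, familyMul_fst hij, e, ← familyMul_fst hij,
        familyMul_comm]
      exact Finset.card_le_card (familyMul_mono (fun m => familyMul_subset_familyShadow _) _ m)
  · exact (card_familyMul_familyShadow hcard hzi).le

end Rigidity

end Family


/-! ### Compression of sets of monomials in two variables -/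

/-- Remove the variables `x_i`, `x_j` from a monomial. -/
noncomputable def dropVars {ι : Type*} (i j : ι) (v : ι →₀ ℕ) : ι →₀ ℕ := (v.erase i).erase j

/-- The exponents of `x_j` in the monomials of `V` which become `m` on removing `x_i`, `x_j`. -/
noncomputable def fiber {ι : Type*} (i j : ι) (V : Finset (ι →₀ ℕ)) (m : ι →₀ ℕ) : Finset ℕ :=
  open Classical in (V.filter (dropVars i j · = m)).image (· j)

open Classical in
/-- The variables that are represented by `x_v` when `x_j` is represented by `x_i`. -/
noncomputable def varClass {ι : Type*} [Fintype ι] (i j v : ι) : Finset ι :=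
  Finset.univ.filter fun α => (if α = j then i else α) = v

section

variable {ι : Type*} {i j : ι} {V : Finset (ι →₀ ℕ)} {m : ι →₀ ℕ} {d : ℕ}

lemma mem_fiber {t : ℕ} : t ∈ fiber i j V m ↔ ∃ u ∈ V, dropVars i j u = m ∧ u j = t := by
  simp [fiber, and_assoc]

lemma dropVars_apply_of_ne {k : ι} (hi : k ≠ i) (hj : k ≠ j) (v : ι →₀ ℕ) :
    dropVars i j v k = v k := by
  rw [dropVars, Finsupp.erase_ne hj, Finsupp.erase_ne hi]

lemma dropVars_fst (hij : i ≠ j) (v : ι →₀ ℕ) : dropVars i j v i = 0 := by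
  rw [dropVars, Finsupp.erase_ne hij, Finsupp.erase_same]

lemma dropVars_snd (v : ι →₀ ℕ) : dropVars i j v j = 0 := by
  rw [dropVars, Finsupp.erase_same]

lemma dropVars_add (u v : ι →₀ ℕ) : dropVars i j (u + v) = dropVars i j u + dropVars i j v := by
  rw [dropVars, Finsupp.erase_add, Finsupp.erase_add, dropVars, dropVars]

lemma dropVars_single_fst (n : ℕ) : dropVars i j (Finsupp.single i n) = 0 := by
  rw [dropVars, Finsupp.erase_single, Finsupp.erase_zero]

lemma dropVars_single_snd (hij : i ≠ j) (n : ℕ) : dropVars i j (Finsupp.single j n) = 0 := by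
  rw [dropVars, Finsupp.erase_single_ne hij, Finsupp.erase_single]

lemma dropVars_single_of_ne {k : ι} (hi : k ≠ i) (hj : k ≠ j) (n : ℕ) :
    dropVars i j (Finsupp.single k n) = Finsupp.single k n := by
  rw [dropVars, Finsupp.erase_single_ne hi.symm, Finsupp.erase_single_ne hj.symm]

lemma dropVars_eq_self (hi : m i = 0) (hj : m j = 0) : dropVars i j m = m := by
  rw [dropVars, Finsupp.erase_of_notMem_support, Finsupp.erase_of_notMem_support]
  · simpa using hi
  · rw [Finsupp.erase_of_notMem_support] <;> simpa

lemma dropVars_add_single (hij : i ≠ j) (v : ι →₀ ℕ) :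
    dropVars i j v + Finsupp.single i (v i) + Finsupp.single j (v j) = v := by
  classical
  ext k
  simp only [Finsupp.add_apply, Finsupp.single_apply]
  by_cases hi : k = i
  · subst hi
    rw [dropVars_fst hij, if_pos rfl, if_neg hij.symm]
    omega
  by_cases hj : k = j
  · subst hj
    rw [dropVars_snd, if_pos rfl, if_neg hij]
    omega
  rw [dropVars_apply_of_ne hi hj, if_neg (Ne.symm hi), if_neg (Ne.symm hj)]
  omega

lemma degree_dropVars (hij : i ≠ j) (v : ι →₀ ℕ) :
    (dropVars i j v).degree + v i + v j = v.degree := by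
  conv_rhs => rw [← dropVars_add_single hij v]
  rw [map_add, map_add, Finsupp.degree_single, Finsupp.degree_single]

lemma eq_of_dropVars_eq (hij : i ≠ j) {u v : ι →₀ ℕ} (hd : u.degree = v.degree)
    (h : dropVars i j u = dropVars i j v) (hj : u j = v j) : u = v := by
  have h1 := degree_dropVars hij u
  have h2 := degree_dropVars hij v
  rw [← dropVars_add_single hij u, ← dropVars_add_single hij v, h, hj,
    show u i = v i by rw [h] at h1; omega]

lemma mem_iff_mem_fiber (hij : i ≠ j) (hV : IsHomogeneousOfDegree d V) {w : ι →₀ ℕ}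
    (hw : w.degree = d) : w ∈ V ↔ w j ∈ fiber i j V (dropVars i j w) := by
  rw [mem_fiber]
  constructor
  · exact fun h => ⟨w, h, rfl, rfl⟩
  · rintro ⟨u, hu, h1, h2⟩
    rwa [← eq_of_dropVars_eq hij ((hV u hu).trans hw.symm) h1 h2]

lemma sum_eq_sum_fiber (hij : i ≠ j) (hV : IsHomogeneousOfDegree d V) {M : Finset (ι →₀ ℕ)}
    (hM : ∀ u ∈ V, dropVars i j u ∈ M) (f : (ι →₀ ℕ) → ℕ → ℕ) :
    ∑ u ∈ V, f (dropVars i j u) (u j) = ∑ m ∈ M, ∑ t ∈ fiber i j V m, f m t := by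
  classical
  rw [← Finset.sum_fiberwise_of_maps_to hM]
  refine Finset.sum_congr rfl fun m _ => ?_
  rw [fiber, Finset.sum_image]
  · refine Finset.sum_congr (by congr!) fun u hu => ?_
    rw [(Finset.mem_filter.1 hu).2]
  · intro u hu v hv huv
    rw [Finset.mem_coe, Finset.mem_filter] at hu hv
    exact eq_of_dropVars_eq hij ((hV u hu.1).trans (hV v hv.1).symm) (hu.2.trans hv.2.symm) huv

lemma card_eq_sum_fiber (hij : i ≠ j) (hV : IsHomogeneousOfDegree d V) {M : Finset (ι →₀ ℕ)}
    (hM : ∀ u ∈ V, dropVars i j u ∈ M) : V.card = ∑ m ∈ M, (fiber i j V m).card := by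
  have := sum_eq_sum_fiber hij hV hM fun _ _ => 1
  simpa using this

variable [Fintype ι]

lemma mem_varClass [DecidableEq ι] {a α : ι} :
    α ∈ varClass i j a ↔ (if α = j then i else α) = a := by
  simp only [varClass, Finset.mem_filter, Finset.mem_univ, true_and]
  by_cases h : α = j <;> simp [h]

lemma mem_varClass_rep (α : ι) [DecidableEq ι] : α ∈ varClass i j (if α = j then i else α) :=
  mem_varClass.2 rfl

lemma fiber_shadowOn_varClass (hij : i ≠ j) (v : ι) :
    fiber i j (shadowOn (varClass i j v) V) m = familyMul i j v (fiber i j V) m := by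
  classical
  ext t
  rw [mem_fiber]
  by_cases hj : v = j
  · subst hj
    rw [familyMul_snd]
    simp only [Finset.notMem_empty, iff_false]
    rintro ⟨w, hw, -⟩
    obtain ⟨α, hα, -⟩ := mem_shadowOn.1 hw
    rw [varClass, Finset.mem_filter] at hα
    split_ifs at hα with h
    · exact hij hα.2
    · exact h hα.2
  by_cases hi : v = i
  · subst hi
    rw [familyMul_fst hij, mem_lineShadow]
    constructor
    · rintro ⟨w, hw, rfl, rfl⟩
      obtain ⟨α, hα, u, hu, rfl⟩ := mem_shadowOn.1 hw
      rw [varClass, Finset.mem_filter] at hα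
      split_ifs at hα with h
      · subst h
        right
        exact ⟨u α, mem_fiber.2 ⟨u, hu, by rw [dropVars_add, dropVars_single_snd hij, add_zero],
          rfl⟩, by simp⟩
      · obtain rfl := hα.2
        left
        exact mem_fiber.2 ⟨u, hu, by rw [dropVars_add, dropVars_single_fst, add_zero],
          by simp [hij]⟩
    · rintro (h | ⟨s, hs, rfl⟩)
      · obtain ⟨u, hu, rfl, rfl⟩ := mem_fiber.1 h
        refine ⟨_, mem_shadowOn.2 ⟨v, ?_, u, hu, rfl⟩, ?_, by simp [hij]⟩
        · simp [varClass]
        · rw [dropVars_add, dropVars_single_fst, add_zero]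
      · obtain ⟨u, hu, rfl, rfl⟩ := mem_fiber.1 hs
        refine ⟨_, mem_shadowOn.2 ⟨j, ?_, u, hu, rfl⟩, ?_, by simp⟩
        · simp [varClass]
        · rw [dropVars_add, dropVars_single_snd hij, add_zero]
  · constructor
    · rintro ⟨w, hw, rfl, rfl⟩
      obtain ⟨α, hα, u, hu, rfl⟩ := mem_shadowOn.1 hw
      rw [varClass, Finset.mem_filter] at hα
      split_ifs at hα with h
      · exact absurd hα.2.symm hi
      · obtain rfl := hα.2
        rw [dropVars_add, dropVars_single_of_ne hi hj, familyMul_of_ne hi hj (by simp),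
          add_tsub_cancel_right]
        exact mem_fiber.2 ⟨u, hu, rfl, by simp [hj]⟩
    · intro h
      by_cases hm : m v = 0
      · rw [familyMul_zero hi hm] at h
        simp at h
      · rw [familyMul_of_ne hi hj hm] at h
        obtain ⟨u, hu, e, rfl⟩ := mem_fiber.1 h
        refine ⟨_, mem_shadowOn.2 ⟨v, ?_, u, hu, rfl⟩, ?_, by simp [hj]⟩
        · simp [varClass, hj]
        · rw [dropVars_add, dropVars_single_of_ne hi hj, e, sub_add_single hm]

lemma fiber_shadow (hij : i ≠ j) :
    fiber i j (shadow V) = familyShadow i j (fiber i j V) := by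
  classical
  funext m
  ext t
  rw [mem_familyShadow]
  simp only [← fiber_shadowOn_varClass hij, mem_fiber]
  constructor
  · rintro ⟨w, hw, h⟩
    obtain ⟨α, u, hu, e⟩ := mem_shadow.1 hw
    exact ⟨_, w, mem_shadowOn.2 ⟨α, mem_varClass_rep α, u, hu, e⟩, h⟩
  · rintro ⟨v, w, hw, h⟩
    obtain ⟨α, -, u, hu, e⟩ := mem_shadowOn.1 hw
    exact ⟨w, mem_shadow.2 ⟨α, u, hu, e⟩, h⟩

/-- The compression of a set of monomials of degree `d` in the variables `x_i`, `x_j`. -/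
noncomputable def compress (i j : ι) (d : ℕ) (V : Finset (ι →₀ ℕ)) : Finset (ι →₀ ℕ) :=
  (allMonomials ι d).filter fun u => u j < (fiber i j V (dropVars i j u)).card

lemma isHomogeneousOfDegree_compress : IsHomogeneousOfDegree d (compress i j d V) :=
  fun _ hu => mem_allMonomials.1 (Finset.mem_filter.1 hu).1

lemma fiber_compress (hij : i ≠ j) (hV : IsHomogeneousOfDegree d V) :
    fiber i j (compress i j d V) = familyCompress (fiber i j V) := by
  funext m
  ext t
  rw [mem_fiber, familyCompress, Finset.mem_range]
  constructor
  · rintro ⟨u, hu, rfl, rfl⟩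
    exact (Finset.mem_filter.1 hu).2
  · intro ht
    obtain ⟨s, hs⟩ := Finset.card_pos.1 (Nat.zero_lt_of_lt ht)
    obtain ⟨u, hu, rfl, rfl⟩ := mem_fiber.1 hs
    -- The degree left for `x_i` and `x_j` is `u i + u j`; this gives `t ≤ u i + u j`, so the
    -- witness below involves no truncation.
    have h1 : fiber i j V (dropVars i j u) ⊆ Finset.range (u i + u j + 1) := by
      intro r hr
      obtain ⟨v, hv, e, rfl⟩ := mem_fiber.1 hr
      have h2 := degree_dropVars hij u
      have h3 := degree_dropVars hij v
      rw [hV u hu] at h2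
      rw [hV v hv, e] at h3
      exact Finset.mem_range.2 (by omega)
    have h2 := Finset.card_le_card h1
    rw [Finset.card_range] at h2
    have h3 : dropVars i j (dropVars i j u + Finsupp.single i (u i + u j - t) +
        Finsupp.single j t) = dropVars i j u := by
      rw [dropVars_add, dropVars_add, dropVars_single_fst, dropVars_single_snd hij, add_zero,
        add_zero, dropVars_eq_self (dropVars_fst hij u) (dropVars_snd u)]
    have h4 : (dropVars i j u + Finsupp.single i (u i + u j - t) + Finsupp.single j t) j = t := by
      simp [dropVars_snd, hij]
    refine ⟨_, Finset.mem_filter.2 ⟨?_, ?_⟩, h3, h4⟩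
    · rw [mem_allMonomials, map_add, map_add, Finsupp.degree_single, Finsupp.degree_single,
        ← hV u hu, ← degree_dropVars hij u]
      omega
    · rw [h3, h4]
      exact ht

lemma card_compress (hij : i ≠ j) (hV : IsHomogeneousOfDegree d V) :
    (compress i j d V).card = V.card := by
  classical
  have hM : ∀ u ∈ V ∪ compress i j d V,
      dropVars i j u ∈ (V ∪ compress i j d V).image (dropVars i j) :=
    fun u hu => Finset.mem_image_of_mem _ hu
  rw [card_eq_sum_fiber hij hV fun u hu => hM u (Finset.mem_union_left _ hu),
    card_eq_sum_fiber hij isHomogeneousOfDegree_compress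
      fun u hu => hM u (Finset.mem_union_right _ hu), fiber_compress hij hV]
  simp [familyCompress]

lemma card_fiber_shadow_compress_le (hij : i ≠ j) (hV : IsHomogeneousOfDegree d V)
    (m : ι →₀ ℕ) :
    (fiber i j (shadow (compress i j d V)) m).card ≤ (fiber i j (shadow V) m).card := by
  have : Nonempty ι := ⟨i⟩
  rw [fiber_shadow hij, fiber_shadow hij, fiber_compress hij hV]
  exact card_familyShadow_compress_le m

lemma card_shadow_compress_le (hij : i ≠ j) (hV : IsHomogeneousOfDegree d V) :
    (shadow (compress i j d V)).card ≤ (shadow V).card := by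
  classical
  have hM : ∀ u ∈ shadow V ∪ shadow (compress i j d V),
      dropVars i j u ∈ (shadow V ∪ shadow (compress i j d V)).image (dropVars i j) :=
    fun u hu => Finset.mem_image_of_mem _ hu
  rw [card_eq_sum_fiber hij hV.shadow fun u hu => hM u (Finset.mem_union_left _ hu),
    card_eq_sum_fiber hij isHomogeneousOfDegree_compress.shadow
      fun u hu => hM u (Finset.mem_union_right _ hu)]
  exact Finset.sum_le_sum fun m _ => card_fiber_shadow_compress_le hij hV m

lemma card_familyShadow_fiber (hij : i ≠ j) (hV : IsHomogeneousOfDegree d V)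
    (h : (shadow V).card = (shadow (compress i j d V)).card) (m : ι →₀ ℕ) :
    (familyShadow i j (fiber i j V) m).card =
      (familyShadow i j (familyCompress (fiber i j V)) m).card := by
  classical
  have hM : ∀ u ∈ shadow V ∪ shadow (compress i j d V), dropVars i j u ∈
      insert m ((shadow V ∪ shadow (compress i j d V)).image (dropVars i j)) :=
    fun u hu => Finset.mem_insert_of_mem (Finset.mem_image_of_mem _ hu)
  rw [card_eq_sum_fiber hij hV.shadow fun u hu => hM u (Finset.mem_union_left _ hu),
    card_eq_sum_fiber hij isHomogeneousOfDegree_compress.shadow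
      fun u hu => hM u (Finset.mem_union_right _ hu)] at h
  -- Equal totals with a one-sided comparison in each fiber force equality in each; `m` was inserted
  -- in the index set so that its own term occurs.
  have := (Finset.sum_eq_sum_iff_of_le fun m _ => card_fiber_shadow_compress_le hij hV m).1
    h.symm m (Finset.mem_insert_self _ _)
  rw [fiber_shadow hij, fiber_shadow hij, fiber_compress hij hV] at this
  exact this.symm

lemma mem_familyMul_familyMul_iff (hij : i ≠ j) (hV : IsHomogeneousOfDegree d V) {w : ι →₀ ℕ}
    (hw : w.degree = d + 2) {a b : ι} :
    w j ∈ familyMul i j a (familyMul i j b (fiber i j V)) (dropVars i j w) ↔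
      ∃ α ∈ varClass i j a, ∃ β ∈ varClass i j b, Linked V w α β := by
  rw [show familyMul i j b (fiber i j V) = fiber i j (shadowOn (varClass i j b) V) from
    funext fun m => (fiber_shadowOn_varClass hij b).symm, ← fiber_shadowOn_varClass hij,
    ← mem_iff_mem_fiber hij ((hV.shadowOn _).shadowOn _) hw, mem_shadowOn]
  constructor
  · rintro ⟨α, hα, s, hs, e⟩
    obtain ⟨β, hβ, u, hu, rfl⟩ := mem_shadowOn.1 hs
    exact ⟨α, hα, β, hβ, u, hu, by rw [add_right_comm, e]⟩
  · rintro ⟨α, hα, β, hβ, u, hu, e⟩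
    exact ⟨α, hα, _, mem_shadowOn.2 ⟨β, hβ, u, hu, rfl⟩, by rw [add_right_comm, e]⟩

lemma exists_dropVars_eq (hij : i ≠ j) (hV : IsHomogeneousOfDegree d V) {a : ι} {t : ℕ}
    (h : t ∈ familyMul i j a (familyShadow i j (fiber i j V)) m) :
    ∃ w : ι →₀ ℕ, w.degree = d + 2 ∧ dropVars i j w = m ∧ w j = t ∧
      ∃ α ∈ varClass i j a, ∃ β, Linked V w α β := by
  rw [← fiber_shadow hij, ← fiber_shadowOn_varClass hij] at h
  obtain ⟨w, hw, h1, h2⟩ := mem_fiber.1 h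
  refine ⟨w, hV.shadow.shadowOn _ w hw, h1, h2, ?_⟩
  obtain ⟨α, hα, s, hs, rfl⟩ := mem_shadowOn.1 hw
  obtain ⟨β, u, hu, rfl⟩ := mem_shadow.1 hs
  exact ⟨α, hα, β, u, hu, add_right_comm _ _ _⟩

lemma reflTransGen_familyMul_compress (hij : i ≠ j) (hV : IsHomogeneousOfDegree d V)
    (hU : HasLinearSyzygies (compress i j d V)) {t : ℕ} {v w : ι}
    (hv : t ∈ familyMul i j v (familyShadow i j (familyCompress (fiber i j V))) m)
    (hw : t ∈ familyMul i j w (familyShadow i j (familyCompress (fiber i j V))) m) :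
    Relation.ReflTransGen (fun a b => t ∈ familyMul i j a (familyMul i j b
      (familyCompress (fiber i j V))) m) v w := by
  classical
  rw [← fiber_compress hij hV] at hv hw ⊢
  obtain ⟨x, hx, rfl, rfl, α, hα, β, hl⟩ :=
    exists_dropVars_eq hij isHomogeneousOfDegree_compress hv
  obtain ⟨y, hy, h1, h2, α', hα', β', hl'⟩ :=
    exists_dropVars_eq hij isHomogeneousOfDegree_compress hw
  obtain rfl := eq_of_dropVars_eq hij (hy.trans hx.symm) h1 h2
  have := hU y α β α' β' hl hl'
  have key := Relation.ReflTransGen.lift (p := fun a b => y j ∈ familyMul i j a (familyMul i j b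
      (fiber i j (compress i j d V))) (dropVars i j y)) (fun α : ι => if α = j then i else α)
      (fun a b hab => (mem_familyMul_familyMul_iff hij isHomogeneousOfDegree_compress hy).2
        ⟨a, mem_varClass_rep a, b, mem_varClass_rep b, hab⟩) _ _ this
  rwa [Function.onFun, mem_varClass.1 hα, mem_varClass.1 hα'] at key

lemma card_shadow_shadow_le_of_compress (hij : i ≠ j) (hV : IsHomogeneousOfDegree d V)
    (h : (shadow V).card = (shadow (compress i j d V)).card)
    (hU : HasLinearSyzygies (compress i j d V)) :
    (shadow (shadow V)).card ≤ (shadow (shadow (compress i j d V))).card := by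
  classical
  have hM : ∀ u ∈ shadow (shadow V) ∪ shadow (shadow (compress i j d V)), dropVars i j u ∈
      (shadow (shadow V) ∪ shadow (shadow (compress i j d V))).image (dropVars i j) :=
    fun u hu => Finset.mem_image_of_mem _ hu
  rw [card_eq_sum_fiber hij hV.shadow.shadow fun u hu => hM u (Finset.mem_union_left _ hu),
    card_eq_sum_fiber hij isHomogeneousOfDegree_compress.shadow.shadow
      fun u hu => hM u (Finset.mem_union_right _ hu)]
  refine Finset.sum_le_sum fun m _ => ?_
  rw [fiber_shadow hij, fiber_shadow hij, fiber_shadow hij, fiber_shadow hij,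
    fiber_compress hij hV]
  exact card_familyShadow_familyShadow_le hij (card_familyShadow_fiber hij hV h)
    fun _ _ _ => reflTransGen_familyMul_compress hij hV hU

/-- The fiber of the shadow contains the exponents of `w / x_i` and `w / x_j`, which are
consecutive. Rigidity gives either `w / (x_i x_j) ∈ V`, a direct edge, or a third variable adjacent
to both. -/
lemma reflTransGen_linked_pair (hij : i ≠ j) (hV : IsHomogeneousOfDegree d V)
    (h : (shadow V).card = (shadow (compress i j d V)).card) {w : ι →₀ ℕ} {β δ : ι}
    (h1 : Linked V w i β) (h2 : Linked V w j δ) : Relation.ReflTransGen (Linked V w) i j := by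
  classical
  obtain ⟨u, hu, rfl⟩ := h1
  obtain ⟨v, hv, e⟩ := h2
  rw [add_right_comm] at e
  set w := u + Finsupp.single i 1 + Finsupp.single β 1 with hw
  have hdw : w.degree = d + 2 := by
    rw [hw, map_add, map_add, hV u hu, Finsupp.degree_single, Finsupp.degree_single]
  have m1 : (v + Finsupp.single δ 1 : ι →₀ ℕ) j + 1 ∈
      familyShadow i j (fiber i j V) (dropVars i j w) := by
    rw [← fiber_shadow hij]
    refine mem_fiber.2 ⟨u + Finsupp.single β 1, mem_shadow.2 ⟨β, u, hu, rfl⟩, ?_, ?_⟩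
    · rw [hw, add_right_comm, dropVars_add (u + _), dropVars_single_fst, add_zero]
    · have := DFunLike.congr_fun e j
      rw [hw, add_right_comm u] at this
      rw [Finsupp.add_apply (v + _), Finsupp.add_apply (u + _), Finsupp.single_eq_same,
        Finsupp.single_eq_of_ne hij.symm] at this
      omega
  have m2 : (v + Finsupp.single δ 1 : ι →₀ ℕ) j ∈
      familyShadow i j (fiber i j V) (dropVars i j w) := by
    rw [← fiber_shadow hij]
    refine mem_fiber.2 ⟨v + Finsupp.single δ 1, mem_shadow.2 ⟨δ, v, hv, rfl⟩, ?_, rfl⟩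
    rw [← e, dropVars_add (v + _), dropVars_single_snd hij, add_zero]
  have hwj : w j = (v + Finsupp.single δ 1 : ι →₀ ℕ) j + 1 := by
    rw [← e, Finsupp.add_apply, Finsupp.single_eq_same]
  rcases mem_or_of_mem_familyShadow hij (card_familyShadow_fiber hij hV h) m2 m1 with
    hA | ⟨k, hki, k1, k2⟩
  · obtain ⟨a, ha, e1, e2⟩ := mem_fiber.1 hA
    refine .single ⟨a, ha, eq_of_dropVars_eq hij ?_ ?_ ?_⟩
    · rw [hdw, map_add, map_add, hV a ha, Finsupp.degree_single, Finsupp.degree_single]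
    · rw [dropVars_add, dropVars_add, dropVars_single_fst, dropVars_single_snd hij, e1, add_zero,
        add_zero]
    · rw [Finsupp.add_apply, Finsupp.add_apply, Finsupp.single_eq_same,
        Finsupp.single_eq_of_ne hij.symm, e2, hwj, add_zero]
  · rw [← fiber_shadowOn_varClass hij] at k1 k2
    have key : ∀ α ∈ varClass i j k, α = k := by
      intro α hα
      have := mem_varClass.1 hα
      split_ifs at this with h'
      · exact absurd this.symm hki
      · exact this
    obtain ⟨s1, hs1, e1, e1'⟩ := mem_fiber.1 k1
    obtain ⟨s2, hs2, e2, e2'⟩ := mem_fiber.1 k2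
    have d1 := (hV.shadowOn _) s1 hs1
    have d2 := (hV.shadowOn _) s2 hs2
    obtain ⟨α, hα, a, ha, rfl⟩ := mem_shadowOn.1 hs1
    obtain ⟨α', hα', b, hb, rfl⟩ := mem_shadowOn.1 hs2
    obtain rfl := key α hα
    obtain rfl := key α' hα'
    have l1 : Linked V w α' j := by
      refine ⟨a, ha, eq_of_dropVars_eq hij ?_ ?_ ?_⟩
      · rw [hdw, map_add, d1, Finsupp.degree_single]
      · rw [dropVars_add (a + _), e1, dropVars_single_snd hij, add_zero]
      · rw [Finsupp.add_apply (a + _), e1', Finsupp.single_eq_same, hwj]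
    have l2 : Linked V w α' i := by
      refine ⟨b, hb, eq_of_dropVars_eq hij ?_ ?_ ?_⟩
      · rw [hdw, map_add, d2, Finsupp.degree_single]
      · rw [dropVars_add (b + _), e2, dropVars_single_fst, add_zero]
      · rw [Finsupp.add_apply (b + _), e2', Finsupp.single_eq_of_ne hij.symm, hwj, add_zero]
    exact .head l2.symm (.single l1)

lemma hasLinearSyzygies_of_compress (hij : i ≠ j) (hV : IsHomogeneousOfDegree d V)
    (h : (shadow V).card = (shadow (compress i j d V)).card)
    (hU : HasLinearSyzygies (compress i j d V)) : HasLinearSyzygies V := by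
  classical
  intro w α β γ δ h1 h2
  have hdw : w.degree = d + 2 := by
    obtain ⟨u, hu, rfl⟩ := h1
    rw [map_add, map_add, hV u hu, Finsupp.degree_single, Finsupp.degree_single]
  -- Paths are first found between classes with `i` and `j` identified; `same` bridges the two
  -- variables inside that class.
  have same : ∀ {α β γ δ a}, α ∈ varClass i j a → γ ∈ varClass i j a → Linked V w α β →
      Linked V w γ δ → Relation.ReflTransGen (Linked V w) α γ := by
    intro α β γ δ a hα hγ h1 h2
    have e := (mem_varClass.1 hα).trans (mem_varClass.1 hγ).symm
    split_ifs at e with c1 c2 c2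
    · rw [c1, c2]
    · subst c1 e
      have := reflTransGen_linked_pair hij hV h h2 h1
      have := this.swap
      exact Relation.ReflTransGen.mono (fun a b hab => Linked.symm hab) _ _ this
    · subst c2 e
      exact reflTransGen_linked_pair hij hV h h1 h2
    · rw [e]
  have vert : ∀ {α β}, Linked V w α β → w j ∈
      familyMul i j (if α = j then i else α) (familyShadow i j (fiber i j V))
        (dropVars i j w) := by
    intro α β hl
    rw [mem_familyMul_familyShadow]
    exact ⟨_, (mem_familyMul_familyMul_iff hij hV hdw).2
      ⟨α, mem_varClass_rep α, β, mem_varClass_rep β, hl⟩⟩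
  have path := reflTransGen_of_mem_familyMul hij (card_familyShadow_fiber hij hV h)
    (fun _ _ _ => reflTransGen_familyMul_compress hij hV hU) (vert h1) (vert h2)
  have key : ∀ a, Relation.ReflTransGen (fun a b => w j ∈ familyMul i j a
      (familyMul i j b (fiber i j V)) (dropVars i j w)) a (if γ = j then i else γ) →
      ∀ α ∈ varClass i j a, ∀ β, Linked V w α β → Relation.ReflTransGen (Linked V w) α γ := by
    intro a ha
    induction ha using Relation.ReflTransGen.head_induction_on with
    | refl => exact fun α hα β hl => same hα (mem_varClass_rep γ) hl h2
    | head hab _ ih =>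
      intro α hα β hl
      obtain ⟨α', hα', β', hβ', hl'⟩ := (mem_familyMul_familyMul_iff hij hV hdw).1 hab
      exact (same hα hα' hl hl').trans (.head hl' (ih β' hβ' α' hl'.symm))
  exact key _ path α (mem_varClass_rep α) β h1

end


/-! ### Reduction to strongly stable sets by a decreasing weight -/

lemma sum_range_card_lt {A : Finset ℕ} (hA : ¬ IsInitialSegment A) :
    ∑ t ∈ Finset.range A.card, t < ∑ t ∈ A, t := by
  have h1 := Finset.sum_inter_add_sum_sdiff (Finset.range A.card) A fun t => t
  have h2 := Finset.sum_inter_add_sum_sdiff A (Finset.range A.card) fun t => t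
  have c1 := Finset.card_inter_add_card_sdiff (Finset.range A.card) A
  have c2 := Finset.card_inter_add_card_sdiff A (Finset.range A.card)
  rw [Finset.inter_comm] at h2 c2
  rw [Finset.card_range] at c1
  have hne : (Finset.range A.card \ A).Nonempty := by
    rw [Finset.nonempty_iff_ne_empty, Ne, Finset.sdiff_eq_empty_iff_subset]
    intro h
    have := Finset.eq_of_subset_of_card_le h (by simp)
    rw [← this] at hA
    exact hA (isInitialSegment_range _)
  have l1 : ∑ t ∈ Finset.range A.card \ A, t < ∑ t ∈ Finset.range A.card \ A, A.card :=
    Finset.sum_lt_sum_of_nonempty hne fun t ht =>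
      Finset.mem_range.1 (Finset.mem_sdiff.1 ht).1
  have l2 : ∑ t ∈ A \ Finset.range A.card, A.card ≤ ∑ t ∈ A \ Finset.range A.card, t :=
    Finset.sum_le_sum fun t ht => not_lt.1 fun h =>
      (Finset.mem_sdiff.1 ht).2 (Finset.mem_range.2 h)
  rw [Finset.sum_const, smul_eq_mul] at l1 l2
  have e : (Finset.range A.card \ A).card = (A \ Finset.range A.card).card := by omega
  rw [e] at l1
  omega

lemma sum_affine_range_card_le (A : Finset ℕ) (a b : ℕ) :
    ∑ t ∈ Finset.range A.card, (a + b * t) ≤ ∑ t ∈ A, (a + b * t) := by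
  rw [Finset.sum_add_distrib, Finset.sum_add_distrib, ← Finset.mul_sum, ← Finset.mul_sum,
    Finset.sum_const, Finset.sum_const, Finset.card_range]
  refine Nat.add_le_add_left (Nat.mul_le_mul_left _ ?_) _
  by_cases hA : IsInitialSegment A
  · rw [← hA.eq_range]
  · exact (sum_range_card_lt hA).le

lemma sum_affine_range_card_lt {A : Finset ℕ} (hA : ¬ IsInitialSegment A) (a : ℕ) {b : ℕ}
    (hb : 0 < b) : ∑ t ∈ Finset.range A.card, (a + b * t) < ∑ t ∈ A, (a + b * t) := by
  rw [Finset.sum_add_distrib, Finset.sum_add_distrib, ← Finset.mul_sum, ← Finset.mul_sum,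
    Finset.sum_const, Finset.sum_const, Finset.card_range]
  exact Nat.add_lt_add_left (Nat.mul_lt_mul_of_pos_left (sum_range_card_lt hA) hb) _

section

variable {n d : ℕ} {i j : Fin n} {V : Finset (Fin n →₀ ℕ)}

/-- The sum of the indices of the variables dividing a monomial, with multiplicities. -/
def indexWeight (u : Fin n →₀ ℕ) : ℕ := ∑ k : Fin n, (k : ℕ) * u k

/-- On a fiber the weight is affine in the exponent of `x_j` with slope `j - i > 0`, so an effective
compression lowers the total weight and the process terminates. -/
lemma indexWeight_eq (hij : i < j) {u : Fin n →₀ ℕ} (hu : u.degree = d) :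
    indexWeight u = indexWeight (dropVars i j u) + i * (d - (dropVars i j u).degree) +
      (j - i) * u j := by
  have h := degree_dropVars hij.ne u
  have e : indexWeight u = indexWeight (dropVars i j u) + i * u i + j * u j := by
    conv_lhs => rw [← dropVars_add_single hij.ne u]
    simp [indexWeight, mul_add, Finset.sum_add_distrib, Finsupp.single_apply]
  obtain ⟨c, hc⟩ := Nat.exists_eq_add_of_lt hij
  rw [e, ← hu, ← h, show (dropVars i j u).degree + u i + u j - (dropVars i j u).degree =
    u i + u j by omega, hc, show (i : ℕ) + c + 1 - i = c + 1 by omega]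
  ring

lemma sum_indexWeight_compress_lt (hij : i < j) (hV : IsHomogeneousOfDegree d V) {m : Fin n →₀ ℕ}
    (hm : ¬ IsInitialSegment (fiber i j V m)) :
    ∑ u ∈ compress i j d V, indexWeight u < ∑ u ∈ V, indexWeight u := by
  classical
  set M := insert m ((V ∪ compress i j d V).image (dropVars i j))
  have hM : ∀ u ∈ V ∪ compress i j d V, dropVars i j u ∈ M :=
    fun u hu => Finset.mem_insert_of_mem (Finset.mem_image_of_mem _ hu)
  have key : ∀ W : Finset (Fin n →₀ ℕ), IsHomogeneousOfDegree d W →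
      (∀ u ∈ W, dropVars i j u ∈ M) → ∑ u ∈ W, indexWeight u = ∑ m ∈ M, ∑ t ∈ fiber i j W m,
        (indexWeight m + i * (d - m.degree) + (j - i) * t) := by
    intro W hW hWM
    rw [← sum_eq_sum_fiber hij.ne hW hWM fun m t =>
      indexWeight m + i * (d - m.degree) + (j - i) * t]
    exact Finset.sum_congr rfl fun u hu => indexWeight_eq hij (hW u hu)
  rw [key V hV fun u hu => hM u (Finset.mem_union_left _ hu),
    key _ isHomogeneousOfDegree_compress fun u hu => hM u (Finset.mem_union_right _ hu),
    fiber_compress hij.ne hV]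
  refine Finset.sum_lt_sum (fun m _ => sum_affine_range_card_le _ _ _)
    ⟨m, Finset.mem_insert_self _ _, sum_affine_range_card_lt hm _ ?_⟩
  rw [Fin.lt_def] at hij
  omega

lemma isStronglyStableOn_of_isInitialSegment (hV : IsHomogeneousOfDegree d V)
    (h : ∀ i j, i < j → ∀ m, IsInitialSegment (fiber i j V m)) :
    IsStronglyStableOn Finset.univ V := by
  refine ⟨fun u _ => Finset.subset_univ _, fun u hu j hj i _ hij => ?_⟩
  have h1 := h i j hij (dropVars i j u) (u j) (mem_fiber.2 ⟨u, hu, rfl, rfl⟩) (u j - 1)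
    (by omega)
  obtain ⟨v, hv, e1, e2⟩ := mem_fiber.1 h1
  refine ⟨v, hv, eq_of_dropVars_eq hij.ne ?_ ?_ ?_⟩
  · rw [map_add, map_add, hV v hv, hV u hu, Finsupp.degree_single, Finsupp.degree_single]
  · rw [dropVars_add, dropVars_add, dropVars_single_fst, dropVars_single_snd hij.ne, e1]
  · rw [Finsupp.add_apply, Finsupp.add_apply, e2, Finsupp.single_eq_same,
      Finsupp.single_eq_of_ne hij.ne']
    omega

lemma induction_compress {P : Finset (Fin n →₀ ℕ) → Prop}
    (hstable : ∀ V, IsHomogeneousOfDegree d V → IsStronglyStableOn Finset.univ V → P V)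
    (hcompress : ∀ V (i j : Fin n), i ≠ j → IsHomogeneousOfDegree d V →
      P (compress i j d V) → P V) (hV : IsHomogeneousOfDegree d V) : P V := by
  induction hN : ∑ u ∈ V, indexWeight u using Nat.strong_induction_on generalizing V with
  | _ N ih =>
    by_cases h : ∀ i j, i < j → ∀ m, IsInitialSegment (fiber i j V m)
    · exact hstable V hV (isStronglyStableOn_of_isInitialSegment hV h)
    · push Not at h
      obtain ⟨i, j, hij, m, hm⟩ := h
      have hlt := sum_indexWeight_compress_lt hij hV hm
      exact hcompress V i j hij.ne hV
        (ih _ (hN ▸ hlt) isHomogeneousOfDegree_compress rfl)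

end

/-! ### Macaulay's theorem and Gotzmann's persistence theorem -/

section

variable {n d : ℕ} {V : Finset (Fin (n + 1) →₀ ℕ)}

/-- **Macaulay's theorem** for sets of monomials. -/
theorem growth_card_le_card_shadow (hV : IsHomogeneousOfDegree d V) :
    growth n V.card ≤ (shadow V).card := by
  refine induction_compress (P := fun V => growth n V.card ≤ (shadow V).card) ?_ ?_ hV
  · intro V hV hs
    exact hs.growth_le (by simp) hV
  · intro V i j hij hV h
    rw [card_compress hij hV] at h
    exact h.trans (card_shadow_compress_le hij hV)

lemma hasLinearSyzygies_and_card_shadow_shadow (hV : IsHomogeneousOfDegree d V)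
    (hG : (shadow V).card = growth n V.card) :
    HasLinearSyzygies V ∧ (shadow (shadow V)).card ≤ growth n (growth n V.card) := by
  refine induction_compress (P := fun V => (shadow V).card = growth n V.card →
    HasLinearSyzygies V ∧ (shadow (shadow V)).card ≤ growth n (growth n V.card)) ?_ ?_ hV hG
  · intro V hV hs hG
    exact ⟨hs.hasLinearSyzygies, (hs.persistence (by simp) hV hG).le⟩
  · intro V i j hij hV ih hG
    -- The shadow of the compression lies between Macaulay's bound and the shadow of `V`; as the
    -- latter attains the bound, all sizes agree and the rigidity results apply.
    have h1 := growth_card_le_card_shadow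
      (isHomogeneousOfDegree_compress (i := i) (j := j) (d := d) (V := V))
    have h2 := card_shadow_compress_le hij hV
    rw [card_compress hij hV] at h1 ih
    obtain ⟨h3, h4⟩ := ih (by omega)
    have h5 : (shadow V).card = (shadow (compress i j d V)).card := by omega
    exact ⟨hasLinearSyzygies_of_compress hij hV h5 h3,
      (card_shadow_shadow_le_of_compress hij hV h5 h3).trans h4⟩

/-- **Gotzmann's persistence theorem** for sets of monomials. -/
theorem card_shadow_shadow_eq (hV : IsHomogeneousOfDegree d V)
    (hG : (shadow V).card = growth n V.card) :
    (shadow (shadow V)).card = growth n (shadow V).card :=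
  le_antisymm (hG ▸ (hasLinearSyzygies_and_card_shadow_shadow hV hG).2)
    (growth_card_le_card_shadow hV.shadow)

lemma card_iterate_shadow_eq (hV : IsHomogeneousOfDegree d V)
    (hG : (shadow V).card = growth n V.card) (k : ℕ) :
    (shadow^[k] V).card = (growth n)^[k] V.card := by
  induction k generalizing V d with
  | zero => rfl
  | succ k ih =>
    rw [Function.iterate_succ_apply, Function.iterate_succ_apply,
      ih hV.shadow (card_shadow_shadow_eq hV hG), hG]

lemma iterate_growth_card_le (hV : IsHomogeneousOfDegree d V) (k : ℕ) :
    (growth n)^[k] V.card ≤ (shadow^[k] V).card := by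
  induction k with
  | zero => exact le_rfl
  | succ k ih =>
    rw [Function.iterate_succ_apply', Function.iterate_succ_apply']
    exact (growth_mono n ih).trans (growth_card_le_card_shadow (hV.iterate_shadow k))

end


/-! ### Necessity of (a) and (b) -/

section

variable {n d : ℕ} {V : Finset (Fin (n + 2) →₀ ℕ)}

lemma IsHomogeneousOfDegree.insert {ι : Type*} [DecidableEq (ι →₀ ℕ)] {W : Finset (ι →₀ ℕ)}
    {v : ι →₀ ℕ} (hW : IsHomogeneousOfDegree d W) (hv : v.degree = d) :
    IsHomogeneousOfDegree d (insert v W) := by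
  intro w hw
  rcases Finset.mem_insert.1 hw with rfl | h
  · exact hv
  · exact hW w h

lemma mem_iterate_shadow_of_le {ι : Type*} [Fintype ι] {W : Finset (ι →₀ ℕ)} {k : ℕ}
    (hW : IsHomogeneousOfDegree d W) {v m : ι →₀ ℕ} (hv : v ∈ W) (hm : m.degree = d + k)
    (hvm : v ≤ m) : m ∈ shadow^[k] W := by
  obtain ⟨z, rfl⟩ := exists_add_of_le hvm
  rw [map_add, hW v hv] at hm
  exact mem_iterate_shadow.2 ⟨v, hv, z, by omega, rfl⟩

lemma allMissingFixedEmpty_of_card_shadow (hV : IsHomogeneousOfDegree d V)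
    (hG : (shadow V).card = growth (n + 1) V.card) : AllMissingFixedEmpty d V := by
  classical
  intro v hv hvV
  by_contra hcon
  have h1 : ∀ i, ∃ w ∈ V, IsUnder i w v := by
    intro i
    by_contra hi
    push Not at hi
    exact hcon ⟨i, hv, hvV, fun w _ hw hwV => hi w hwV hw⟩
  have hdeg : v.degree = d := hv
  set N := (n + 2) * d
  have h2 : shadow^[N] (insert v V) ⊆ shadow^[N] V := by
    intro m hm
    obtain ⟨w, hw, z, hz, rfl⟩ := mem_iterate_shadow.1 hm
    rcases Finset.mem_insert.1 hw with rfl | hwV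
    · obtain ⟨i, -, hi⟩ : ∃ i ∈ (Finset.univ : Finset (Fin (n + 2))), d ≤ z i := by
        -- By the choice of `N`, some exponent of `z` is at least `d`. It absorbs the one exponent
        -- in which the element of `V` under `v` may exceed `v`.
        refine Finset.exists_le_of_sum_le Finset.univ_nonempty ?_
        rw [← Finsupp.degree_eq_sum, hz]
        simp [N]
      obtain ⟨x, hx, hxw⟩ := h1 i
      refine mem_iterate_shadow_of_le hV hx (by rw [map_add, hdeg, hz]) fun k => ?_
      rw [Finsupp.add_apply]
      by_cases hk : k = i
      · subst hk
        have := Finsupp.le_degree k x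
        rw [hV x hx] at this
        omega
      · have := hxw k hk
        omega
    · exact mem_iterate_shadow.2 ⟨w, hwV, z, hz, rfl⟩
  have h3 := iterate_growth_card_le (n := n + 1) (hV.insert hdeg) N
  have h4 := Finset.card_le_card h2
  rw [card_iterate_shadow_eq hV hG] at h4
  have h5 := (growth_strictMono n).iterate N (Nat.lt_succ_self V.card)
  rw [Finset.card_insert_of_notMem hvV] at h3
  exact absurd h5 (not_lt.2 (h3.trans h4))

lemma gcdMonomial_le (hne : V.Nonempty) {v : Fin (n + 2) →₀ ℕ} (hv : v ∈ V) :
    gcdMonomial V hne ≤ v :=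
  Finset.inf'_le id hv

lemma exists_eq_gcdMonomial (hne : V.Nonempty) (i : Fin (n + 2)) :
    ∃ v ∈ V, v i = gcdMonomial V hne i := by
  have h : gcdMonomial V hne i = V.inf' hne fun v => v i :=
    Finset.apply_inf'_eq_inf'_comp hne (fun v : Fin (n + 2) →₀ ℕ => v i)
      fun u v => Finsupp.inf_apply u v i
  obtain ⟨v, hv, e⟩ := Finset.exists_mem_eq_inf' hne fun v => v i
  exact ⟨v, hv, by rw [h, e]⟩

lemma card_add_card_filter {ι : Type*} [Fintype ι] [DecidableEq (ι →₀ ℕ)]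
    {T : Finset (ι →₀ ℕ)} {u : ι →₀ ℕ} {e : ℕ}
    (hT : IsHomogeneousOfDegree (u.degree + e) T) (hu : ∀ v ∈ T, u ≤ v) :
    T.card + ((allMonomials ι e).filter fun z => u + z ∉ T).card = (allMonomials ι e).card := by
  have h : T = ((allMonomials ι e).filter fun z => u + z ∈ T).image (u + ·) := by
    ext v
    simp only [Finset.mem_image, Finset.mem_filter, mem_allMonomials]
    constructor
    · intro hv
      obtain ⟨z, rfl⟩ := exists_add_of_le (hu v hv)
      have := hT _ hv
      rw [map_add] at this
      exact ⟨z, ⟨by omega, hv⟩, rfl⟩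
    · rintro ⟨z, ⟨-, hz⟩, rfl⟩
      exact hz
  have h2 : T.card = ((allMonomials ι e).filter fun z => u + z ∈ T).card := by
    conv_lhs => rw [h]
    exact Finset.card_image_of_injective _ (add_right_injective u)
  rw [h2, Finset.card_filter_add_card_filter_not]

/-- Dropping two fixed exponents leaves monomials in `n` variables, at most `(D + n - 1).choose (n -
1)` of them for `n ≥ 1`; the absorption identity compares this with `(D + n).choose n`. For `n = 0`
there are none, as `a + b < D`. -/
lemma card_filter_two_exponents_le {D a b : ℕ} {i j : Fin (n + 2)} (hij : i ≠ j)
    (hD : a + b < D) :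
    ((allMonomials (Fin (n + 2)) D).filter fun z => z i = a ∧ z j = b).card * (D + n) ≤
      (D + n).choose n * n := by
  classical
  have h1 : ((allMonomials (Fin (n + 2)) D).filter fun z => z i = a ∧ z j = b).card ≤
      (((Finset.univ.erase i).erase j).finsuppAntidiag (D - a - b)).card := by
    refine Finset.card_le_card_of_injOn (dropVars i j) ?_ ?_
    · intro z hz
      rw [Finset.mem_coe, Finset.mem_filter, mem_allMonomials] at hz
      rw [Finset.mem_coe, Finset.mem_finsuppAntidiag]
      have hs : (dropVars i j z).support ⊆ (Finset.univ.erase i).erase j := by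
        intro k hk
        rw [Finsupp.mem_support_iff] at hk
        refine Finset.mem_erase.2 ⟨?_, Finset.mem_erase.2 ⟨?_, Finset.mem_univ _⟩⟩
        · rintro rfl
          exact hk (dropVars_snd z)
        · rintro rfl
          exact hk (dropVars_fst hij z)
      refine ⟨?_, hs⟩
      have h := degree_dropVars hij z
      rw [hz.1, hz.2.1, hz.2.2, Finsupp.degree_apply, Finset.sum_subset hs] at h
      · change ∑ k ∈ (Finset.univ.erase i).erase j, dropVars i j z k = _
        omega
      · intro k _ hk
        rwa [Finsupp.notMem_support_iff] at hk
    · intro y hy z hz h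
      rw [Finset.mem_coe, Finset.mem_filter, mem_allMonomials] at hy hz
      exact eq_of_dropVars_eq hij (hy.1.trans hz.1.symm) h (hy.2.2.trans hz.2.2.symm)
  rw [Finset.card_finsuppAntidiag_nat_eq_choose, Finset.card_erase_of_mem
    (Finset.mem_erase.2 ⟨hij.symm, Finset.mem_univ _⟩), Finset.card_erase_of_mem
    (Finset.mem_univ _), Finset.card_univ, Fintype.card_fin] at h1
  obtain ⟨c, hc⟩ := Nat.exists_eq_add_of_lt hD
  rw [show n + 2 - 1 - 1 + (D - a - b) - 1 = n + c by omega,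
    show D - a - b = c + 1 by omega] at h1
  cases n with
  | zero =>
    rw [Nat.choose_eq_zero_of_lt (by omega)] at h1
    simp [Nat.le_zero.1 h1]
  | succ n =>
    have e : (n + 1 + c).choose (c + 1) = (c + 1 + n).choose n := by
      rw [show n + 1 + c = c + 1 + n by omega, Nat.choose_symm_add]
    rw [e] at h1
    rw [← add_assoc D, ← Nat.add_one_mul_choose_eq, mul_comm]
    exact Nat.mul_le_mul_left _ (h1.trans (Nat.choose_le_choose n (by omega)))

lemma card_filter_two_small_lt {e D : ℕ} (hD : 2 * e + ((n + 2) * (n + 2) * (e * e)) * n < D) :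
    ((allMonomials (Fin (n + 2)) D).filter fun z => ∃ i j, i ≠ j ∧ z i < e ∧ z j < e).card <
      (D + n).choose n := by
  classical
  -- Union bound over two positions and two values below `e`; the size of `P` is the factor in `hD`,
  -- and `2 * e` ensures `a + b < D`.
  set P := ((Finset.univ : Finset (Fin (n + 2))) ×ˢ (Finset.univ : Finset (Fin (n + 2)))) ×ˢ
    (Finset.range e ×ˢ Finset.range e)
  set F : (Fin (n + 2) × Fin (n + 2)) × (ℕ × ℕ) → Finset (Fin (n + 2) →₀ ℕ) := fun p =>
    (allMonomials (Fin (n + 2)) D).filter fun z =>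
      p.1.1 ≠ p.1.2 ∧ z p.1.1 = p.2.1 ∧ z p.1.2 = p.2.2
  have h1 : ((allMonomials (Fin (n + 2)) D).filter
      fun z => ∃ i j, i ≠ j ∧ z i < e ∧ z j < e) ⊆ P.biUnion F := by
    intro z hz
    obtain ⟨hz, i, j, hij, hi, hj⟩ := Finset.mem_filter.1 hz
    refine Finset.mem_biUnion.2 ⟨((i, j), (z i, z j)), ?_, Finset.mem_filter.2
      ⟨hz, hij, rfl, rfl⟩⟩
    simp [P, hi, hj]
  have h2 : ∀ p ∈ P, (F p).card * (D + n) ≤ (D + n).choose n * n := by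
    rintro ⟨⟨i, j⟩, a, b⟩ hp
    simp only [P, Finset.mem_product, Finset.mem_univ, true_and, Finset.mem_range] at hp
    by_cases hij : i = j
    · simp [F, hij]
    · simp only [F, ne_eq, hij, not_false_eq_true, true_and]
      exact card_filter_two_exponents_le hij (by omega)
  have h3 : ((P.biUnion F).card) * (D + n) ≤
      ((n + 2) * (n + 2) * (e * e)) * ((D + n).choose n * n) := by
    calc (P.biUnion F).card * (D + n) ≤ (∑ p ∈ P, (F p).card) * (D + n) :=
          Nat.mul_le_mul_right _ Finset.card_biUnion_le
      _ = ∑ p ∈ P, (F p).card * (D + n) := Finset.sum_mul _ _ _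
      _ ≤ ∑ p ∈ P, (D + n).choose n * n := Finset.sum_le_sum h2
      _ = _ := by simp [P]
  have h4 : 0 < (D + n).choose n := Nat.choose_pos (by omega)
  refine (Finset.card_le_card h1).trans_lt ?_
  refine lt_of_mul_lt_mul_right (h3.trans_lt ?_) (Nat.zero_le (D + n))
  rw [mul_comm ((D + n).choose n) n, ← mul_assoc, mul_comm]
  exact Nat.mul_lt_mul_of_pos_left (by omega) h4

lemma iterate_growth_choose (m b k : ℕ) :
    (growth m)^[k] ((b + m).choose m) = (b + k + m).choose m := by
  induction k with
  | zero => rfl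
  | succ k ih => rw [Function.iterate_succ_apply', ih, growth_choose, add_assoc b k 1]

lemma choose_lt_card_of_card_shadow (hV : IsHomogeneousOfDegree d V) (hne : V.Nonempty)
    (hG : (shadow V).card = growth (n + 1) V.card) :
    (d - (gcdMonomial V hne).degree + n).choose (n + 1) < V.card := by
  classical
  set u := gcdMonomial V hne
  have hud : u.degree ≤ d := by
    obtain ⟨v, hv⟩ := hne
    rw [← hV v hv]
    exact Finsupp.degree_mono (gcdMonomial_le _ hv)
  obtain ⟨e, he⟩ := Nat.exists_eq_add_of_le hud
  rw [he, Nat.add_sub_cancel_left]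
  by_contra hcon
  push Not at hcon
  obtain ⟨b, rfl⟩ : ∃ b, e = b + 1 := by
    rcases e with _ | b
    · rw [Nat.choose_eq_zero_of_lt (by omega)] at hcon
      have := hne.card_pos
      omega
    · exact ⟨b, rfl⟩
  set e := b + 1 with hedef
  set k := 2 * e + ((n + 2) * (n + 2) * (e * e)) * n + 1
  have h1 : (shadow^[k] V).card ≤ (b + k + (n + 1)).choose (n + 1) := by
    rw [card_iterate_shadow_eq hV hG, ← iterate_growth_choose]
    refine (growth_mono (n + 1)).iterate k ?_
    rwa [show b + (n + 1) = e + n by omega]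
  have h2 := card_add_card_filter (T := shadow^[k] V) (u := u) (e := e + k)
    (by rw [← add_assoc, ← he]; exact hV.iterate_shadow k) (by
      intro m hm
      obtain ⟨v, hv, z, -, rfl⟩ := mem_iterate_shadow.1 hm
      exact (gcdMonomial_le hne hv).trans le_self_add)
  have h3 : ((allMonomials (Fin (n + 2)) (e + k)).filter fun z => u + z ∉ shadow^[k] V) ⊆
      (allMonomials (Fin (n + 2)) (e + k)).filter
        fun z => ∃ i j, i ≠ j ∧ z i < e ∧ z j < e := by
    intro z hz
    rw [Finset.mem_filter] at hz ⊢
    refine ⟨hz.1, ?_⟩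
    by_contra hc
    push Not at hc
    apply hz.2
    -- If only `z i` may be small, a `v ∈ V` with `v i = u i` divides `u z`, since its other
    -- exponents exceed those of `u` by at most `e`.
    obtain ⟨i, hi⟩ : ∃ i, ∀ j, j ≠ i → e ≤ z j := by
      by_cases h0 : ∃ i, z i < e
      · obtain ⟨i, hi⟩ := h0
        exact ⟨i, fun j hj => hc i j hj.symm hi⟩
      · push Not at h0
        exact ⟨0, fun j _ => h0 j⟩
    obtain ⟨v, hv, hvi⟩ := exists_eq_gcdMonomial hne i
    refine mem_iterate_shadow_of_le hV hv ?_ fun l => ?_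
    · rw [map_add, mem_allMonomials.1 hz.1, he]
      exact (add_assoc _ _ _).symm
    · rw [Finsupp.add_apply]
      by_cases hl : l = i
      · subst hl
        rw [hvi]
        exact Nat.le_add_right _ _
      · obtain ⟨y, rfl⟩ := exists_add_of_le (show u ≤ v from gcdMonomial_le hne hv)
        have h4 := hV _ hv
        rw [map_add] at h4
        have h5 := Finsupp.le_degree l y
        have h6 := hi l hl
        rw [Finsupp.add_apply]
        omega
  have h4 := Finset.card_le_card h3
  have h5 := card_filter_two_small_lt (n := n) (e := e) (D := e + k) (by omega)
  rw [card_allMonomials (n + 1)] at h2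
  have h6 := choose_pascal_shift (b + k) n
  rw [show e + k = b + k + 1 by omega] at h2 h4 h5
  omega

end

/-! ### The converse in three variables -/

section ThreeVariables

lemma exists_third {i j : Fin 3} (hij : i ≠ j) :
    ∃ k, k ≠ i ∧ k ≠ j ∧ ∀ y : Fin 3 →₀ ℕ, y.degree = y i + y j + y k := by
  have : ∃ k, k ≠ i ∧ k ≠ j ∧ ({i, j, k} : Finset (Fin 3)) = Finset.univ := by
    revert i j; decide
  obtain ⟨k, h1, h2, h3⟩ := this
  refine ⟨k, h1, h2, fun y => ?_⟩
  rw [Finsupp.degree_eq_sum, ← h3, Finset.sum_insert (by simp [hij, h1.symm]),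
    Finset.sum_insert (by simp [h2.symm]), Finset.sum_singleton, add_assoc]

lemma degree_lt_card_of_under {e : ℕ} {W : Finset (Fin 3 →₀ ℕ)} {z : Fin 3 →₀ ℕ} {i j : Fin 3}
    (hij : i ≠ j) (hz : z.degree = e)
    (hW : ∀ y : Fin 3 →₀ ℕ, y.degree = e → IsUnder i y z ∨ IsUnder j y z → y ∈ W) :
    e < W.card := by
  obtain ⟨k, hki, hkj, hdeg⟩ := exists_third hij
  -- A chain of `e + 1` monomials: exponent moves from `x_j` to `x_i` with `z k` fixed, then from
  -- `x_k` to `x_i` with `x_j` restored to `z j`. Before `t = z i` the terms are under `z` for `j`,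
  -- afterwards for `i`.
  set g : ℕ → Fin 3 →₀ ℕ := fun t => if t ≤ z i + z j then
    Finsupp.single i t + Finsupp.single j (z i + z j - t) + Finsupp.single k (z k) else
    Finsupp.single i (t - z j) + Finsupp.single j (z j) + Finsupp.single k (e - t)
  have gi : ∀ t, g t i = if t ≤ z i + z j then t else t - z j := by
    intro t
    simp only [g]
    split_ifs <;> simp [hij, hki.symm]
  have gj : ∀ t, g t j = if t ≤ z i + z j then z i + z j - t else z j := by
    intro t
    simp only [g]
    split_ifs <;> simp [hij.symm, hkj.symm]
  have gk : ∀ t, g t k = if t ≤ z i + z j then z k else e - t := by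
    intro t
    simp only [g]
    split_ifs <;> simp [hki, hkj]
  have hze := hdeg z
  have only : ∀ l, l = i ∨ l = j ∨ l = k := by
    intro l
    by_contra hl
    push Not at hl
    have := hdeg (Finsupp.single l 1)
    rw [Finsupp.degree_single, Finsupp.single_eq_of_ne hl.1.symm,
      Finsupp.single_eq_of_ne hl.2.1.symm, Finsupp.single_eq_of_ne hl.2.2.symm] at this
    omega
  have h : (Finset.range (e + 1)).card ≤ W.card := by
    refine Finset.card_le_card_of_injOn g ?_ ?_
    · intro t ht
      rw [Finset.mem_coe, Finset.mem_range] at ht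
      refine hW _ ?_ ?_
      · rw [hdeg, gi, gj, gk]
        split_ifs <;> omega
      · by_cases hti : t < z i
        · right
          intro l hl
          rcases only l with rfl | rfl | rfl
          · rw [gi, if_pos (by omega)]; omega
          · exact absurd rfl hl
          · rw [gk, if_pos (by omega)]
        · left
          intro l hl
          rcases only l with rfl | rfl | rfl
          · exact absurd rfl hl
          · rw [gj]; split_ifs <;> omega
          · rw [gk]; split_ifs <;> omega
    · intro s hs t ht hst
      rw [Finset.mem_coe, Finset.mem_range] at hs ht
      have e1 := DFunLike.congr_fun hst i
      have e3 := DFunLike.congr_fun hst k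
      rw [gi, gi] at e1
      rw [gk, gk] at e3
      split_ifs at e1 e3 <;> omega
  rw [Finset.card_range] at h
  omega

variable {d : ℕ} {V : Finset (Fin 3 →₀ ℕ)}

lemma card_shadow_le_of_fixedEmpty (hV : IsHomogeneousOfDegree d V) (hne : V.Nonempty)
    (ha : AllMissingFixedEmpty d V)
    (hb : (d - (gcdMonomial V hne).degree + 1).choose 2 < V.card) :
    (shadow V).card ≤ growth 2 V.card := by
  classical
  set u := gcdMonomial V hne
  have hud : u.degree ≤ d := by
    obtain ⟨v, hv⟩ := hne
    rw [← hV v hv]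
    exact Finsupp.degree_mono (gcdMonomial_le (n := 1) _ hv)
  obtain ⟨e, he⟩ := Nat.exists_eq_add_of_le hud
  rw [he, Nat.add_sub_cancel_left] at hb
  have h1 := card_add_card_filter (T := V) (u := u) (e := e) (he ▸ hV)
    fun v hv => gcdMonomial_le (n := 1) hne hv
  have h2 := card_add_card_filter (T := shadow V) (u := u) (e := e + 1)
    (by rw [← add_assoc, ← he]; exact hV.shadow) (by
      intro m hm
      obtain ⟨i, v, hv, rfl⟩ := mem_shadow.1 hm
      exact (gcdMonomial_le (n := 1) hne hv).trans le_self_add)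
  rw [card_allMonomials 2] at h1 h2
  set W := (allMonomials (Fin 3) e).filter fun z => u + z ∉ V
  set Z := (allMonomials (Fin 3) (e + 1)).filter fun z => u + z ∉ shadow V
  have c1 : (e + 2).choose 2 = (e + 1).choose 2 + (e + 1) := by
    rw [Nat.choose_succ_succ' (e + 1) 1, Nat.choose_one_right, add_comm]
  have c2 : (e + 1 + 2).choose 2 = (e + 2).choose 2 + (e + 2) := by
    rw [Nat.choose_succ_succ' (e + 2) 1, Nat.choose_one_right, add_comm]
  have hWe : W.card ≤ e := by omega
  have hfix : ∀ z ∈ W, ∃ i, IsFixedEmpty d V i (u + z) := by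
    intro z hz
    obtain ⟨hz1, hz2⟩ := Finset.mem_filter.1 hz
    refine ha _ ?_ hz2
    change (u + z).degree = d
    rw [map_add, mem_allMonomials.1 hz1, he]
  have under_mem : ∀ z i, IsFixedEmpty d V i (u + z) → ∀ y : Fin 3 →₀ ℕ, y.degree = e →
      IsUnder i y z → y ∈ W := by
    intro z i hzi y hy hyz
    refine Finset.mem_filter.2 ⟨mem_allMonomials.2 hy, hzi.2.2 _ ?_ fun l hl => ?_⟩
    · change (u + y).degree = d
      rw [map_add, hy, he]
    · rw [Finsupp.add_apply, Finsupp.add_apply]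
      exact Nat.add_le_add_left (hyz l hl) _
  choose! f hf using hfix
  -- A collision of `z` and `y` with different variables makes `y` under `z` for `f z`. Then
  -- everything under `y` for `f z` or `f y` is missing, which is more than `e` cofactors, against
  -- `hWe`.
  have hWZ : W.card ≤ Z.card := by
    refine Finset.card_le_card_of_injOn (fun z => z + Finsupp.single (f z) 1) ?_ ?_
    · intro z hz
      have hz1 := mem_allMonomials.1 (Finset.mem_filter.1 hz).1
      refine Finset.mem_filter.2 ⟨?_, ?_⟩
      · rw [mem_allMonomials, map_add, hz1, Finsupp.degree_single]
      · intro hmem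
        obtain ⟨j, v, hv, e1⟩ := mem_shadow.1 hmem
        refine (hf z hz).2.2 v (hV v hv) (fun l hl => ?_) hv
        have := DFunLike.congr_fun e1 l
        rw [← add_assoc, Finsupp.add_apply v, Finsupp.add_apply (u + z),
          Finsupp.single_eq_of_ne hl] at this
        omega
    · intro z hz y hy hzy
      by_contra hne'
      have hzy' : z + Finsupp.single (f z) 1 = y + Finsupp.single (f y) 1 := hzy
      have hij : f z ≠ f y := by
        intro h
        rw [h] at hzy'
        exact hne' (add_right_cancel hzy')
      have hyz : IsUnder (f z) y z := by
        intro l hl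
        have := DFunLike.congr_fun hzy' l
        rw [Finsupp.add_apply, Finsupp.add_apply, Finsupp.single_eq_of_ne hl] at this
        omega
      have hy1 := mem_allMonomials.1 (Finset.mem_filter.1 hy).1
      have := degree_lt_card_of_under (W := W) (z := y) hij hy1 fun x hx h => by
        rcases h with h | h
        · exact under_mem z (f z) (hf z hz) x hx fun l hl => (h l hl).trans (hyz l hl)
        · exact under_mem y (f y) (hf y hy) x hx h
      omega
  cases e with
  | zero =>
    have h3 := growth_one 2
    have : V.card = 1 := by
      have := hne.card_pos
      simp at h1
      omega
    rw [this, h3]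
    simp only [Nat.zero_add, Nat.choose_self] at c2 h2 c1
    omega
  | succ b =>
    -- By (b), `|V|` is the binomial of (b) plus a remainder `r + 1`, whose growth is `r + 2`; this
    -- is the count of all cofactors of degree `e + 1` minus `|W|`.
    obtain ⟨r, hr⟩ := Nat.exists_eq_add_of_lt hb
    have h3 : r + 1 ≤ (b + 1 + 1).choose 1 := by
      rw [Nat.choose_one_right]
      omega
    have h4 := growth_choose_add h3
    have h5 := growth_choose 1 r
    rw [Nat.choose_one_right, Nat.choose_one_right] at h5
    rw [hr, add_assoc _ r 1]
    rw [show b + (1 + 1) = b + 1 + 1 by omega, show b + 1 + (1 + 1) = b + 1 + 2 by omega] at h4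
    change _ ≤ growth (1 + 1) _
    rw [h4, h5]
    change _ ≤ (b + 1 + 2).choose 2 + _
    omega

end ThreeVariables

end GotzmannSets

/-- Writing the upper index as `d - deg u + n - 2` keeps it correct for `deg u = d`: it is then `n -
2` and the binomial vanishes. -/
theorem mainTheorem2 (K : Type*) [Field K] :
    (∀ (n d : ℕ) (V : Finset (Fin n →₀ ℕ)) (hV : V.Nonempty), 2 ≤ n →
      (V : Set (Fin n →₀ ℕ)) ⊆ GotzmannSets.monomialsOfDegree n d →
      GotzmannSets.IsGotzmannSet K d V →
        GotzmannSets.AllMissingFixedEmpty d V ∧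
        (d - (GotzmannSets.gcdMonomial V hV).degree + n - 2).choose (n - 1) < V.card) ∧
    (∀ (d : ℕ) (V : Finset (Fin 3 →₀ ℕ)) (hV : V.Nonempty),
      (V : Set (Fin 3 →₀ ℕ)) ⊆ GotzmannSets.monomialsOfDegree 3 d →
      (GotzmannSets.IsGotzmannSet K d V ↔
        GotzmannSets.AllMissingFixedEmpty d V ∧
        (d - (GotzmannSets.gcdMonomial V hV).degree + 3 - 2).choose (3 - 1) < V.card)) := by
  have key : ∀ (n d : ℕ) (V : Finset (Fin n →₀ ℕ)) (hV : V.Nonempty), 2 ≤ n →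
      (V : Set (Fin n →₀ ℕ)) ⊆ GotzmannSets.monomialsOfDegree n d →
      GotzmannSets.IsGotzmannSet K d V →
        GotzmannSets.AllMissingFixedEmpty d V ∧
        (d - (GotzmannSets.gcdMonomial V hV).degree + n - 2).choose (n - 1) < V.card := by
    intro n d V hV hn hd hG
    obtain ⟨n, rfl⟩ := Nat.exists_eq_add_of_le' hn
    have hd' : GotzmannSets.IsHomogeneousOfDegree d V := fun v hv => hd hv
    rw [GotzmannSets.isGotzmannSet_iff hd'] at hG
    exact ⟨GotzmannSets.allMissingFixedEmpty_of_card_shadow hd' hG,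
      GotzmannSets.choose_lt_card_of_card_shadow hd' hV hG⟩
  refine ⟨key, fun d V hV hd => ⟨key 3 d V hV (by omega) hd, ?_⟩⟩
  rintro ⟨ha, hb⟩
  have hd' : GotzmannSets.IsHomogeneousOfDegree d V := fun v hv => hd hv
  rw [GotzmannSets.isGotzmannSet_iff (n := 1) hd']
  exact le_antisymm (GotzmannSets.card_shadow_le_of_fixedEmpty hd' hV ha hb)
    (GotzmannSets.growth_card_le_card_shadow hd')
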